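/- **Conventions.** A simplicial fan $\Delta$ in a finite-dimensional real vector space $V$ is a finite fan all of whose cones are simplicial, with a fixed generator $v_i$ on each ray $\rho_i$; suppose $\Delta$ is of pure dimension $d$. Its Chow ring is the graded ring $$CH(\Delta)=\mathbb R[x_i : \rho_i \text{ a ray of } \Delta]\big/(I+J),$$ where $I$ is generated by the monomials $\prod_{i\in S}x_i$ such that $\{v_i\}_{i\in S}$ does not generate a cone of $\Delta$, and $J$ is generated by the linear forms $\sum_i\theta(v_i)x_i$ with $\theta\in V^*$. Write $x_\sigma=\prod_{\rho_i\subset\sigma}x_i$. A Minkowski weight of degree $d$ on $\Delta$ is a family of real numbers $w_\sigma$, indexed by the $d$-dimensional cones, such that for each $(d-1)$-dimensional cone $\rho$ one has $\sum_{\sigma\supset\rho}w_\sigma v_{\sigma/\rho}\in\operatorname{span}\rho$, where $v_{\sigma/\rho}$ is the generator of the ray of $\sigma$ not in $\rho$. It determines the degree map $\deg_w: CH^d(\Delta)\to\mathbb R$, $x_\sigma\mapsto w_\sigma$. Let $\tau\in\Delta$ be a $2$-dimensional cone with ray generators $v_1,v_2$, and let $\hat\Delta$ be the star subdivision of $\Delta$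 at $\tau$ with new ray generator $v_0=v_1+v_2$. Let $s^*:CH(\Delta)\to CH(\hat\Delta)$ be the pullback of piecewise polynomial functions along $s:\hat\Delta\to\Delta$, so $s^*x_i=x_i+x_0$ for $i=1,2$ and $s^*x_i=x_i$ otherwise. The link of $\tau$ is the fan in $V/\operatorname{span}\tau$ formed by the images of the cones $\sigma$ with $\sigma\cap\tau=0$ that lie with $\tau$ in a common cone of $\Delta$; its ray generators are the images of those of $\Delta$. For $f\in CH(\Delta)$, $f|_{\operatorname{Link}\tau}$ is the image of $f$ under restriction to the star of $\tau$ followed by the inverse of the isomorphism $CH(\operatorname{Link}_\Delta\tau)\to CH(\operatorname{Star}_\Delta\tau)$, $x_k\mapsto x_k$. A Minkowski weight $w$ on $\Delta$ induces the weight $\operatorname{res}(w)$ on $\operatorname{Link}_\Delta\tau$ whose value on the image of $\gamma$ is $w_{\gamma+\tau}$, and the weight $\hat w$ on $\hat\Delta$ whose value on $\sigma$ is $w$ at the $d$-dimensional cone of $\Delta$ containing $\sigma$. For a graded commutative $\mathbb R$-algebra $H$, $\deg:H^e\to\mathbb R$ and $\ell\in H^1$: * $H$ satisfies *Poincaré duality*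 in degree $e$ with respect to $\deg$ if $H^i=0$ for $i>e$, $\deg: H^e\to\mathbb R$ is an isomorphism and the pairings $H^i\times H^{e-i}\to\mathbb R$, $(x,y)\mapsto\deg(xy)$, are non-degenerate; * $(H,\ell)$ satisfies *Hard Lefschetz* if $\ell^{e-2i}:H^i\to H^{e-i}$ is an isomorphism for all $0\le i\le e/2$; * $(H,\ell)$ satisfies the *Hodge–Riemann relations* if for all $0\le i\le e/2$ the form $x\mapsto(-1)^i\deg(x\cdot\ell^{e-2i}x)$ is positive definite on $\ker(\ell^{e-2i+1}:H^i\to H^{e-i+1})$. Below $e=d$ for $CH(\Delta)$ and $CH(\hat\Delta)$ and $e=d-2$ for $CH(\operatorname{Link}_\Delta\tau)$. **Proposition.** Let $\Delta$ be a simplicial fan of pure dimension $d$, $w$ a Minkowski weight of degree $d$ on $\Delta$, $\tau\in\Delta$ a $2$-dimensional cone, and $\ell\in CH^1(\Delta)$. 1. If $(CH(\Delta),\ell)$ and $(CH(\operatorname{Link}_\Delta\tau),\ell|_{\operatorname{Link}\tau})$ satisfy Hard Lefschetz, then so does $(CH(\hat\Delta),s^*\ell)$. 2. Suppose that $CH(\Delta)$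 and $CH(\operatorname{Link}_\Delta\tau)$ satisfy Poincaré duality with respect to $\deg_w$ and $\deg_{\operatorname{res}(w)}$. Then $CH(\hat\Delta)$ satisfies Poincaré duality with respect to $\deg_{\hat w}$. If moreover $(CH(\Delta),\ell)$ and $(CH(\operatorname{Link}_\Delta\tau),\ell|_{\operatorname{Link}\tau})$ satisfy the Hodge–Riemann relations for these degree maps, then so does $(CH(\hat\Delta),s^*\ell)$ for $\deg_{\hat w}$. -/

import Mathlib

noncomputable section

/-! ## Graded algebras: Poincaré duality, Hard Lefschetz, Hodge-Riemann

Throughout, a graded algebra is given by a commutative `ℝ`-algebra `H` and its homogeneous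
parts `H i`, here `gr i`, as subspaces of `H`. -/

/-- The graded algebra `(H, gr)` has highest degree `d` and satisfies Poincaré duality with
respect to `deg`: `deg` is an isomorphism from the part of degree `d` to `ℝ`, and the pairings
`(x, y) ↦ deg (x * y)` between degrees `i` and `d - i` are non-degenerate
(in both arguments, by exchanging `i` and `j`). -/
structure SatisfiesPoincareDuality {H : Type*} [CommRing H] [Algebra ℝ H]
    (gr : ℕ → Submodule ℝ H) (d : ℕ) (deg : H →ₗ[ℝ] ℝ) : Prop where
  eq_bot : ∀ i, d < i → gr i = ⊥
  bijective_deg : Function.Bijective (deg ∘ₗ (gr d).subtype)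
  nondegenerate : ∀ i j, i + j = d → ∀ x ∈ gr i, (∀ y ∈ gr j, deg (x * y) = 0) → x = 0

/-- Hard Lefschetz: for `0 ≤ i ≤ d / 2`, multiplication by `ℓ ^ (d - 2 * i)` is an isomorphism
from degree `i` to degree `d - i`. -/
def SatisfiesHardLefschetz {H : Type*} [CommRing H] [Algebra ℝ H]
    (gr : ℕ → Submodule ℝ H) (d : ℕ) (ℓ : H) : Prop :=
  ∀ i, 2 * i ≤ d → Set.BijOn (fun x => ℓ ^ (d - 2 * i) * x) (gr i) (gr (d - i))

/-- The bilinear form `B_ℓ (x, y) = deg (x * ℓ ^ (d - 2 * i) * y)`, for `x`, `y` of degree `i`. -/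
def lefschetzForm {H : Type*} [CommRing H] [Algebra ℝ H]
    (d : ℕ) (deg : H →ₗ[ℝ] ℝ) (ℓ : H) (i : ℕ) (x y : H) : ℝ :=
  deg (x * (ℓ ^ (d - 2 * i) * y))

/-- The primitive part of degree `i`: the kernel of multiplication by `ℓ ^ (d - 2 * i + 1)`
on the part of degree `i`. -/
def primitivePart {H : Type*} [CommRing H] [Algebra ℝ H]
    (gr : ℕ → Submodule ℝ H) (d : ℕ) (ℓ : H) (i : ℕ) : Submodule ℝ H :=
  gr i ⊓ LinearMap.ker (LinearMap.mulLeft ℝ (ℓ ^ (d - 2 * i + 1)))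

/-- The Hodge-Riemann relations: for `0 ≤ i ≤ d / 2`, the quadratic form
`x ↦ (-1) ^ i * B_ℓ (x, x)` is positive definite on the primitive part of degree `i`. -/
def SatisfiesHodgeRiemann {H : Type*} [CommRing H] [Algebra ℝ H]
    (gr : ℕ → Submodule ℝ H) (d : ℕ) (deg : H →ₗ[ℝ] ℝ) (ℓ : H) : Prop :=
  ∀ i, 2 * i ≤ d → ∀ x ∈ primitivePart gr d ℓ i, x ≠ 0 →
    0 < (-1 : ℝ) ^ i * lefschetzForm d deg ℓ i x x

/-! ## Simplicial fans -/

/-- The convex polyhedral cone generated by the vectors `ray i`, `i ∈ s`. -/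
def rayCone {ι V : Type*} [AddCommGroup V] [Module ℝ V] (ray : ι → V) (s : Set ι) :
    PointedCone ℝ V :=
  PointedCone.hull ℝ (ray '' s)

/-- A simplicial fan in `V` with a chosen generator on each ray. A cone of the fan is recorded by
the set `σ ∈ faces` of the labels of its rays; the cone itself is `rayCone ray σ`. The cones are
simplicial (`linearIndepOn`), every face of a cone is in the fan (`down_closed`; the faces of a
simplicial cone are the cones over the subsets of its generators), and any two cones meet in a
common face (`inter`). The rays of the fan are labelled by those `i` with `{i} ∈ faces`; other
labels are allowed and play no role. -/
structure SimplicialFan (ι V : Type*) [AddCommGroup V] [Module ℝ V] where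
  ray : ι → V
  faces : Set (Finset ι)
  empty_mem : ∅ ∈ faces
  down_closed : ∀ σ ∈ faces, ∀ ρ, ρ ⊆ σ → ρ ∈ faces
  linearIndepOn : ∀ σ ∈ faces, LinearIndepOn ℝ ray (σ : Set ι)
  inter : ∀ σ ∈ faces, ∀ ρ ∈ faces,
    rayCone ray (σ : Set ι) ⊓ rayCone ray (ρ : Set ι) = rayCone ray ((σ : Set ι) ∩ (ρ : Set ι))

namespace SimplicialFan

section Cones

variable {ι V : Type*} [AddCommGroup V] [Module ℝ V]

theorem mem_rayCone_iff [Fintype ι] {ray : ι → V} {s : Set ι} {x : V} :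
    x ∈ rayCone ray s ↔
      ∃ a : ι → ℝ, (∀ i, 0 ≤ a i) ∧ (∀ i, i ∉ s → a i = 0) ∧ ∑ i, a i • ray i = x := by
  classical
  constructor
  · intro hx
    induction hx using Submodule.span_induction with
    | mem x hx =>
      obtain ⟨i, hi, rfl⟩ := hx
      refine ⟨Pi.single i 1, fun j => ?_, fun j hj => ?_, ?_⟩
      · by_cases h : j = i
        · subst h; simp
        · simp [h]
      · have : j ≠ i := fun h => hj (h ▸ hi)
        simp [this]
      · rw [Finset.sum_eq_single i] <;> simp +contextual
    | zero => exact ⟨0, by simp, by simp, by simp⟩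
    | add x y _ _ hx hy =>
      obtain ⟨a, ha, ha', rfl⟩ := hx
      obtain ⟨b, hb, hb', rfl⟩ := hy
      exact ⟨a + b, fun i => add_nonneg (ha i) (hb i),
        fun i hi => by simp [ha' i hi, hb' i hi], by simp [add_smul, Finset.sum_add_distrib]⟩
    | smul c x _ hx =>
      obtain ⟨a, ha, ha', rfl⟩ := hx
      refine ⟨fun i => (c : ℝ) * a i, fun i => mul_nonneg c.2 (ha i),
        fun i hi => by simp [ha' i hi], ?_⟩
      simp only [mul_smul, ← Finset.smul_sum]
      rfl
  · rintro ⟨a, ha, ha', rfl⟩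
    refine Submodule.sum_mem _ fun i _ => ?_
    by_cases hi : i ∈ s
    · exact Submodule.smul_mem (rayCone ray s) (⟨a i, ha i⟩ : {c : ℝ // 0 ≤ c})
        (Submodule.subset_span ⟨i, hi, rfl⟩)
    · rw [ha' i hi, zero_smul]
      exact Submodule.zero_mem _

theorem rayCone_mono {ray : ι → V} {s t : Set ι} (h : s ⊆ t) : rayCone ray s ≤ rayCone ray t :=
  Submodule.span_mono (Set.image_mono h)

/-- Linear combinations of the generators of one cone are unique. -/
theorem coeff_eq_of_mem [Fintype ι] (Δ : SimplicialFan ι V) {σ : Finset ι} (hσ : σ ∈ Δ.faces)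
    {a b : ι → ℝ} (ha : ∀ i, i ∉ σ → a i = 0) (hb : ∀ i, i ∉ σ → b i = 0)
    (h : ∑ i, a i • Δ.ray i = ∑ i, b i • Δ.ray i) : a = b := by
  classical
  have hli := linearIndepOn_finset_iff.mp (Δ.linearIndepOn σ hσ) (fun i => a i - b i) (by
    rw [Finset.sum_subset (Finset.subset_univ σ)]
    · simp only [sub_smul, Finset.sum_sub_distrib, h, sub_self]
    · intro i _ hi
      simp [ha i hi, hb i hi])
  funext i
  by_cases hi : i ∈ σ
  · exact sub_eq_zero.mp (hli i hi)
  · rw [ha i hi, hb i hi]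

/-- A point in the support of a fan has unique non-negative coordinates supported on a cone. -/
theorem coeff_eq [Fintype ι] (Δ : SimplicialFan ι V) {σ ρ : Finset ι} (hσ : σ ∈ Δ.faces)
    (hρ : ρ ∈ Δ.faces) {a b : ι → ℝ} (ha : ∀ i, 0 ≤ a i) (hb : ∀ i, 0 ≤ b i)
    (ha' : ∀ i, i ∉ σ → a i = 0) (hb' : ∀ i, i ∉ ρ → b i = 0)
    (h : ∑ i, a i • Δ.ray i = ∑ i, b i • Δ.ray i) : a = b := by
  have h1 : ∑ i, a i • Δ.ray i ∈ rayCone Δ.ray (σ : Set ι) :=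
    mem_rayCone_iff.mpr ⟨a, ha, ha', rfl⟩
  have h2 : ∑ i, a i • Δ.ray i ∈ rayCone Δ.ray (ρ : Set ι) :=
    mem_rayCone_iff.mpr ⟨b, hb, hb', h.symm⟩
  have h3 : ∑ i, a i • Δ.ray i ∈ rayCone Δ.ray ((σ : Set ι) ∩ (ρ : Set ι)) := by
    rw [← Δ.inter σ hσ ρ hρ]
    exact ⟨h1, h2⟩
  obtain ⟨c, -, hc', hc⟩ := mem_rayCone_iff.mp h3
  have hac : c = a := Δ.coeff_eq_of_mem hσ (fun i hi => hc' i fun hi' => hi hi'.1) ha' hc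
  have hbc : c = b := Δ.coeff_eq_of_mem hρ (fun i hi => hc' i fun hi' => hi hi'.2) hb' (hc.trans h)
  rw [← hac, hbc]

/-- The fan axioms follow from the uniqueness of coordinates. -/
def ofUnique [Fintype ι] (ray : ι → V) (faces : Set (Finset ι)) (empty_mem : ∅ ∈ faces)
    (down_closed : ∀ σ ∈ faces, ∀ ρ, ρ ⊆ σ → ρ ∈ faces)
    (unique : ∀ σ ∈ faces, ∀ ρ ∈ faces, ∀ a b : ι → ℝ, (∀ i, 0 ≤ a i) → (∀ i, 0 ≤ b i) →
      (∀ i, i ∉ σ → a i = 0) → (∀ i, i ∉ ρ → b i = 0) →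
      ∑ i, a i • ray i = ∑ i, b i • ray i → a = b) : SimplicialFan ι V where
  ray := ray
  faces := faces
  empty_mem := empty_mem
  down_closed := down_closed
  linearIndepOn := by
    classical
    intro σ hσ
    rw [linearIndepOn_finset_iff]
    intro f hf i hi
    have := unique σ hσ σ hσ (fun i => if i ∈ σ then (f i)⁺ else 0)
      (fun i => if i ∈ σ then (f i)⁻ else 0)
      (fun i => by split_ifs <;> simp)
      (fun i => by split_ifs <;> simp)
      (fun i hi => by simp [hi]) (fun i hi => by simp [hi]) (by
        rw [← sub_eq_zero, ← Finset.sum_sub_distrib, ← hf,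
          ← Finset.sum_subset (Finset.subset_univ σ)]
        · refine Finset.sum_congr rfl fun i hi => ?_
          simp only [hi, if_true, ← sub_smul, posPart_sub_negPart]
        · intro i _ hi
          simp [hi])
    have h := congrFun this i
    simp only [hi, if_true] at h
    rw [← posPart_sub_negPart (f i), h, sub_self]
  inter := by
    intro σ hσ ρ hρ
    apply le_antisymm
    · rintro x ⟨h1, h2⟩
      obtain ⟨a, ha, ha', rfl⟩ := mem_rayCone_iff.mp h1
      obtain ⟨b, hb, hb', h⟩ := mem_rayCone_iff.mp h2
      have hab := unique σ hσ ρ hρ a b ha hb ha' hb' h.symm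
      refine mem_rayCone_iff.mpr ⟨a, ha, fun i hi => ?_, rfl⟩
      by_cases h : i ∈ σ
      · rw [hab]
        exact hb' i fun h' => hi ⟨h, h'⟩
      · exact ha' i h
    · exact le_inf (rayCone_mono Set.inter_subset_left) (rayCone_mono Set.inter_subset_right)

end Cones

section Constructions

variable {ι V : Type*} [AddCommGroup V] [Module ℝ V]

/-- The fan has pure dimension `d`: all maximal cones have dimension `d`. -/
def IsPure (Δ : SimplicialFan ι V) (d : ℕ) : Prop :=
  ∀ σ ∈ Δ.faces, (∀ ρ ∈ Δ.faces, σ ⊆ ρ → ρ = σ) → σ.card = d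

/-- The star of a cone: the subfan of all cones that lie in a common cone of `Δ` with `τ`. -/
def star (Δ : SimplicialFan ι V) (τ : Finset ι) (hτ : τ ∈ Δ.faces) : SimplicialFan ι V where
  ray := Δ.ray
  faces := {σ | ∃ γ ∈ Δ.faces, τ ⊆ γ ∧ σ ⊆ γ}
  empty_mem := ⟨τ, hτ, subset_rfl, Finset.empty_subset _⟩
  down_closed := fun _ ⟨γ, hγ, h1, h2⟩ _ hρ => ⟨γ, hγ, h1, hρ.trans h2⟩
  linearIndepOn := fun σ ⟨γ, hγ, _, h2⟩ => Δ.linearIndepOn σ (Δ.down_closed γ hγ σ h2)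
  inter := fun σ ⟨γ, hγ, _, h2⟩ ρ ⟨γ', hγ', _, h2'⟩ =>
    Δ.inter σ (Δ.down_closed γ hγ σ h2) ρ (Δ.down_closed γ' hγ' ρ h2')

/-- The linear span of a cone. -/
def coneSpan (Δ : SimplicialFan ι V) (τ : Finset ι) : Submodule ℝ V :=
  Submodule.span ℝ (Δ.ray '' (τ : Set ι))

theorem exists_coeff_of_mem_coneSpan [Fintype ι] (Δ : SimplicialFan ι V) {τ : Finset ι} {x : V}
    (hx : x ∈ Δ.coneSpan τ) :
    ∃ c : ι → ℝ, (∀ i, i ∉ τ → c i = 0) ∧ ∑ i, c i • Δ.ray i = x := by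
  classical
  obtain ⟨c, rfl⟩ := (Submodule.mem_span_image_finset_iff_exists_fun ℝ).mp hx
  refine ⟨fun i => if h : i ∈ τ then c ⟨i, h⟩ else 0, fun i hi => by simp [hi], ?_⟩
  rw [← Finset.sum_subset (Finset.subset_univ τ), ← Finset.sum_coe_sort τ]
  · exact Finset.sum_congr rfl fun i _ => by simp
  · intro i _ hi
    simp [hi]

/-- The link of a cone: the cones of the star that meet `τ` only in `0`,
as a fan in `V / span τ`, with the images of the ray generators of `Δ` as ray generators. -/
def link [Fintype ι] (Δ : SimplicialFan ι V) (τ : Finset ι) (hτ : τ ∈ Δ.faces) :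
    SimplicialFan ι (V ⧸ Δ.coneSpan τ) :=
  ofUnique (fun i => (Δ.coneSpan τ).mkQ (Δ.ray i))
    {σ | σ ∈ (Δ.star τ hτ).faces ∧ Disjoint σ τ}
    ⟨(Δ.star τ hτ).empty_mem, Finset.disjoint_empty_left _⟩
    (fun σ hσ ρ hρ => ⟨(Δ.star τ hτ).down_closed σ hσ.1 ρ hρ, hσ.2.mono_left hρ⟩)
    (by
      rintro σ ⟨⟨γ, hγ, hτγ, hσγ⟩, hστ⟩ ρ ⟨⟨γ', hγ', hτγ', hργ'⟩, hρτ⟩ a b ha hb ha' hb' h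
      have h0 : ∑ i, a i • Δ.ray i - ∑ i, b i • Δ.ray i ∈ Δ.coneSpan τ := by
        rw [← Submodule.ker_mkQ (Δ.coneSpan τ), LinearMap.mem_ker, map_sub, map_sum, map_sum]
        simpa only [map_smul, sub_eq_zero] using h
      obtain ⟨c, hc, hc'⟩ := Δ.exists_coeff_of_mem_coneSpan h0
      have key := Δ.coeff_eq hγ hγ' (a := fun i => a i + (c i)⁻) (b := fun i => b i + (c i)⁺)
        (fun i => add_nonneg (ha i) (negPart_nonneg _))
        (fun i => add_nonneg (hb i) (posPart_nonneg _))
        (fun i hi => by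
          simp [ha' i fun h => hi (hσγ h), hc i fun h => hi (hτγ h)])
        (fun i hi => by
          simp [hb' i fun h => hi (hργ' h), hc i fun h => hi (hτγ' h)])
        (by
          simp only [add_smul, Finset.sum_add_distrib]
          have : ∑ i, c i • Δ.ray i = ∑ i, (c i)⁺ • Δ.ray i - ∑ i, (c i)⁻ • Δ.ray i := by
            rw [← Finset.sum_sub_distrib]
            exact Finset.sum_congr rfl fun i _ => by rw [← sub_smul, posPart_sub_negPart]
          rw [this] at hc'
          rw [sub_eq_sub_iff_add_eq_add] at hc'
          rw [← hc']
          abel)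
      funext i
      by_cases hi : i ∈ τ
      · rw [ha' i fun h => Finset.disjoint_left.mp hστ h hi,
          hb' i fun h => Finset.disjoint_left.mp hρτ h hi]
      · simpa [hc i hi] using congrFun key i)

/-- The star subdivision of `Δ` at a cone `τ` of dimension two with generators `v₁`, `v₂`:
the new ray, labelled `none`, is generated by `v₀ = v₁ + v₂`. The cones that contain `τ` are
replaced by the cones spanned by `v₀` and those faces of the star of `τ` that do not contain
`τ`. -/
def starSubdivision [Fintype ι] (Δ : SimplicialFan ι V) (τ : Finset ι) (hτ : τ ∈ Δ.faces)
    (hτ2 : τ.card = 2) : SimplicialFan (Option ι) V :=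
  ofUnique (fun i => i.elim (∑ j ∈ τ, Δ.ray j) Δ.ray)
    {σ | ¬ τ ⊆ σ.eraseNone ∧ σ.eraseNone ∈ Δ.faces ∧
      (none ∈ σ → σ.eraseNone ∈ (Δ.star τ hτ).faces)}
    ⟨by
      intro h
      have h' := Finset.card_le_card h
      simp [hτ2] at h',
      by simpa using Δ.empty_mem, by simp⟩
    (fun σ hσ ρ hρ => ⟨fun h => hσ.1 (h.trans (Finset.eraseNone.monotone hρ)),
      Δ.down_closed _ hσ.2.1 _ (Finset.eraseNone.monotone hρ),
      fun h => (Δ.star τ hτ).down_closed _ (hσ.2.2 (hρ h)) _ (Finset.eraseNone.monotone hρ)⟩)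
    (by
      classical
      -- a cone of `Δ` that contains the given cone of the subdivision
      have hface : ∀ σ : Finset (Option ι), σ.eraseNone ∈ Δ.faces →
          (none ∈ σ → σ.eraseNone ∈ (Δ.star τ hτ).faces) →
          ∃ γ ∈ Δ.faces, σ.eraseNone ⊆ γ ∧ (none ∈ σ → τ ⊆ γ) := by
        intro σ h1 h2
        by_cases hn : none ∈ σ
        · obtain ⟨γ, hγ, h3, h4⟩ := h2 hn
          exact ⟨γ, hγ, h4, fun _ => h3⟩
        · exact ⟨_, h1, subset_rfl, fun h => absurd h hn⟩
      have hsum : ∀ a : Option ι → ℝ,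
          ∑ i, a i • (i.elim (∑ j ∈ τ, Δ.ray j) Δ.ray : V) =
            ∑ i, (a (some i) + if i ∈ τ then a none else 0) • Δ.ray i := by
        intro a
        rw [Fintype.sum_option]
        simp only [Option.elim, add_smul, Finset.sum_add_distrib, ite_smul, zero_smul,
          Finset.smul_sum, Finset.sum_ite_mem, Finset.univ_inter]
        rw [add_comm]
      have hsupp : ∀ (σ : Finset (Option ι)) (γ : Finset ι) (a : Option ι → ℝ),
          σ.eraseNone ⊆ γ → (none ∈ σ → τ ⊆ γ) → (∀ i, i ∉ σ → a i = 0) →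
          ∀ i, i ∉ γ → (a (some i) + if i ∈ τ then a none else 0) = 0 := by
        intro σ γ a h1 h2 ha i hi
        rw [ha (some i) fun h => hi (h1 (Finset.mem_eraseNone.mpr h)), zero_add]
        split_ifs with hiτ
        · exact ha none fun h => hi (h2 h hiτ)
        · rfl
      -- the coordinate of `v₀` is determined by the coordinates in `Δ`
      have hle : ∀ (σ : Finset (Option ι)) (a b : Option ι → ℝ), ¬ τ ⊆ σ.eraseNone →
          (∀ i, 0 ≤ b i) → (∀ i, i ∉ σ → a i = 0) →
          (∀ i, (a (some i) + if i ∈ τ then a none else 0) =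
            (b (some i) + if i ∈ τ then b none else 0)) → b none ≤ a none := by
        intro σ a b hσ hb ha hab
        obtain ⟨i, hi, hi'⟩ := Finset.not_subset.mp hσ
        have h := hab i
        rw [ha (some i) fun h => hi' (Finset.mem_eraseNone.mpr h), if_pos hi, if_pos hi] at h
        have := hb (some i)
        linarith
      rintro σ ⟨hσ1, hσ2, hσ3⟩ ρ ⟨hρ1, hρ2, hρ3⟩ a b ha hb ha' hb' h
      obtain ⟨γ, hγ, h1, h2⟩ := hface σ hσ2 hσ3
      obtain ⟨γ', hγ', h1', h2'⟩ := hface ρ hρ2 hρ3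
      rw [hsum, hsum] at h
      have key := Δ.coeff_eq hγ hγ'
        (fun i => add_nonneg (ha _) (by split_ifs; exacts [ha _, le_rfl]))
        (fun i => add_nonneg (hb _) (by split_ifs; exacts [hb _, le_rfl]))
        (hsupp σ γ a h1 h2 ha') (hsupp ρ γ' b h1' h2' hb') h
      have key' := congrFun key
      have hnone : a none = b none :=
        le_antisymm (hle ρ b a hρ1 ha hb' fun i => (key' i).symm) (hle σ a b hσ1 hb ha' key')
      funext i
      cases i with
      | none => exact hnone
      | some i => simpa [hnone] using key' i)

end Constructions

/-! ## Chow rings -/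

section Chow

open MvPolynomial

variable {ι V : Type*} [Fintype ι] [AddCommGroup V] [Module ℝ V]

/-- The linear function `θ` on `V` as an element of the polynomial ring on the rays. -/
def linearForm (Δ : SimplicialFan ι V) (θ : Module.Dual ℝ V) : MvPolynomial ι ℝ :=
  ∑ i, C (θ (Δ.ray i)) * X i

/-- The ideal of relations of the Chow ring: the Stanley-Reisner ideal, generated by the
square-free monomials whose rays do not generate a cone, plus the ideal generated by the global
linear functions. -/
def chowIdeal (Δ : SimplicialFan ι V) : Ideal (MvPolynomial ι ℝ) :=
  Ideal.span {p | ∃ S : Finset ι, S ∉ Δ.faces ∧ p = ∏ i ∈ S, X i} ⊔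
    Ideal.span (Set.range Δ.linearForm)

/-- The Chow ring of a simplicial fan. -/
abbrev Chow (Δ : SimplicialFan ι V) : Type _ := MvPolynomial ι ℝ ⧸ Δ.chowIdeal

/-- The part of degree `k` of the Chow ring. -/
def chowDegree (Δ : SimplicialFan ι V) (k : ℕ) : Submodule ℝ Δ.Chow :=
  (homogeneousSubmodule ι ℝ k).map (Ideal.Quotient.mkₐ ℝ Δ.chowIdeal).toLinearMap

/-- The class of the variable `x i`. -/
def x (Δ : SimplicialFan ι V) (i : ι) : Δ.Chow := Ideal.Quotient.mk Δ.chowIdeal (X i)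

theorem prod_x_eq_zero (Δ : SimplicialFan ι V) {S : Finset ι} (hS : S ∉ Δ.faces) :
    ∏ i ∈ S, Δ.x i = 0 := by
  simp only [x, ← map_prod]
  exact Ideal.Quotient.eq_zero_iff_mem.mpr (Ideal.mem_sup_left (Ideal.subset_span ⟨S, hS, rfl⟩))

theorem x_eq_zero (Δ : SimplicialFan ι V) {i : ι} (hi : {i} ∉ Δ.faces) : Δ.x i = 0 := by
  simpa using Δ.prod_x_eq_zero hi

theorem sum_smul_x_eq_zero (Δ : SimplicialFan ι V) (θ : Module.Dual ℝ V) :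
    ∑ i, θ (Δ.ray i) • Δ.x i = 0 := by
  have h : Ideal.Quotient.mk Δ.chowIdeal (Δ.linearForm θ) = 0 :=
    Ideal.Quotient.eq_zero_iff_mem.mpr (Ideal.mem_sup_right (Ideal.subset_span ⟨θ, rfl⟩))
  rw [← h, linearForm, map_sum]
  refine Finset.sum_congr rfl fun i _ => ?_
  rw [map_mul]
  exact Algebra.smul_def (θ (Δ.ray i)) (Δ.x i)

/-- Algebra homomorphisms out of the Chow ring, by generators and relations. -/
def chowLift (Δ : SimplicialFan ι V) {A : Type*} [CommRing A] [Algebra ℝ A] (y : ι → A)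
    (h1 : ∀ S : Finset ι, S ∉ Δ.faces → ∏ i ∈ S, y i = 0)
    (h2 : ∀ θ : Module.Dual ℝ V, ∑ i, θ (Δ.ray i) • y i = 0) : Δ.Chow →ₐ[ℝ] A :=
  Ideal.Quotient.liftₐ Δ.chowIdeal (aeval y) (by
    have h : Δ.chowIdeal ≤ RingHom.ker (aeval y : MvPolynomial ι ℝ →ₐ[ℝ] A) := by
      rw [chowIdeal, sup_le_iff, Ideal.span_le, Ideal.span_le]
      constructor
      · rintro _ ⟨S, hS, rfl⟩
        simpa [RingHom.mem_ker] using h1 S hS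
      · rintro _ ⟨θ, rfl⟩
        simpa [RingHom.mem_ker, linearForm, Algebra.smul_def] using h2 θ
    exact fun a ha => h ha)

@[simp]
theorem chowLift_x (Δ : SimplicialFan ι V) {A : Type*} [CommRing A] [Algebra ℝ A] (y : ι → A)
    (h1 : ∀ S : Finset ι, S ∉ Δ.faces → ∏ i ∈ S, y i = 0)
    (h2 : ∀ θ : Module.Dual ℝ V, ∑ i, θ (Δ.ray i) • y i = 0) (i : ι) :
    Δ.chowLift y h1 h2 (Δ.x i) = y i := by
  exact aeval_X y i

theorem chow_hom_ext (Δ : SimplicialFan ι V) {A : Type*} [CommRing A] [Algebra ℝ A]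
    {f g : Δ.Chow →ₐ[ℝ] A} (h : ∀ i, f (Δ.x i) = g (Δ.x i)) : f = g :=
  Ideal.Quotient.algHom_ext _ (MvPolynomial.algHom_ext h)

end Chow

/-! ## Morphisms of fans and pullbacks -/

/-- A morphism of fans: a linear map `f` that maps every cone of `Δ₁` into a cone of `Δ₂`,
together with the coordinates `coeff i j` of the image of the ray generator `i` of `Δ₁` with
respect to the generators `j` of a cone of `Δ₂`, which are the values `x_j (f v_i)`
of the piecewise linear functions `x_j` of `Δ₂`. -/
structure FanMap {ι₁ V₁ ι₂ V₂ : Type*} [Fintype ι₂] [AddCommGroup V₁] [Module ℝ V₁]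
    [AddCommGroup V₂] [Module ℝ V₂] (Δ₁ : SimplicialFan ι₁ V₁) (Δ₂ : SimplicialFan ι₂ V₂) where
  toLinearMap : V₁ →ₗ[ℝ] V₂
  coeff : ι₁ → ι₂ → ℝ
  coeff_nonneg : ∀ i j, 0 ≤ coeff i j
  map_ray : ∀ i, {i} ∈ Δ₁.faces → toLinearMap (Δ₁.ray i) = ∑ j, coeff i j • Δ₂.ray j
  map_cone : ∀ σ ∈ Δ₁.faces, ∃ ρ ∈ Δ₂.faces, ∀ i ∈ σ, ∀ j, coeff i j ≠ 0 → j ∈ ρ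

section Pullback

variable {ι₁ V₁ ι₂ V₂ : Type*} [Fintype ι₁] [Fintype ι₂] [AddCommGroup V₁] [Module ℝ V₁]
  [AddCommGroup V₂] [Module ℝ V₂] {Δ₁ : SimplicialFan ι₁ V₁} {Δ₂ : SimplicialFan ι₂ V₂}

/-- The pullback of Chow rings along a morphism of fans. The pullback of the piecewise linear
function `x_j` is the piecewise linear function whose value on the ray generator `v_i` of `Δ₁` is
`x_j (f v_i)`. -/
def FanMap.pullback (f : FanMap Δ₁ Δ₂) : Δ₂.Chow →ₐ[ℝ] Δ₁.Chow :=
  Δ₂.chowLift (fun j => ∑ i, f.coeff i j • Δ₁.x i)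
    (by
      classical
      intro S hS
      rw [← Finset.prod_coe_sort S, Finset.prod_univ_sum]
      refine Finset.sum_eq_zero fun p _ => ?_
      by_cases hp : Finset.univ.image p ∈ Δ₁.faces
      · obtain ⟨ρ, hρ, h⟩ := f.map_cone _ hp
        have hSρ : ¬ S ⊆ ρ := fun h' => hS (Δ₂.down_closed ρ hρ S h')
        obtain ⟨j, hj, hjρ⟩ := Finset.not_subset.mp hSρ
        refine Finset.prod_eq_zero (Finset.mem_univ (⟨j, hj⟩ : S)) ?_
        have h0 : f.coeff (p ⟨j, hj⟩) j = 0 := by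
          by_contra hne
          exact hjρ (h _ (Finset.mem_image_of_mem p (Finset.mem_univ _)) j hne)
        rw [h0, zero_smul]
      · rw [Finset.prod_smul, Finset.prod_comp Δ₁.x p]
        have hdvd : ∏ i ∈ Finset.univ.image p, Δ₁.x i ∣
            ∏ i ∈ Finset.univ.image p, Δ₁.x i ^ (Finset.univ.filter (p · = i)).card := by
          refine Finset.prod_dvd_prod_of_dvd _ _ fun i hi => dvd_pow_self _ ?_
          obtain ⟨j, -, hj⟩ := Finset.mem_image.mp hi
          exact (Finset.card_pos.mpr ⟨j, by simp [hj]⟩).ne'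
        rw [Δ₁.prod_x_eq_zero hp, zero_dvd_iff] at hdvd
        rw [hdvd, smul_zero])
    (by
      intro θ
      simp only [Finset.smul_sum]
      rw [Finset.sum_comm, ← Δ₁.sum_smul_x_eq_zero (θ ∘ₗ f.toLinearMap)]
      refine Finset.sum_congr rfl fun i _ => ?_
      by_cases hi : {i} ∈ Δ₁.faces
      · rw [LinearMap.comp_apply, f.map_ray i hi, map_sum, Finset.sum_smul]
        exact Finset.sum_congr rfl fun j _ => by rw [map_smul, smul_smul, smul_eq_mul, mul_comm]
      · simp [Δ₁.x_eq_zero hi])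

theorem FanMap.pullback_x (f : FanMap Δ₁ Δ₂) (j : ι₂) :
    f.pullback (Δ₂.x j) = ∑ i, f.coeff i j • Δ₁.x i :=
  Δ₂.chowLift_x _ _ _ j

end Pullback

/-- Linear functions dual to the generators of a cone. -/
theorem exists_dual {ι V : Type*} [DecidableEq ι] [AddCommGroup V] [Module ℝ V]
    (Δ : SimplicialFan ι V) {τ : Finset ι} (hτ : τ ∈ Δ.faces) :
    ∃ θ : ι → Module.Dual ℝ V, ∀ i ∈ τ, ∀ j ∈ τ, θ i (Δ.ray j) = if i = j then 1 else 0 := by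
  have hli := Δ.linearIndepOn τ hτ
  let b := Module.Basis.span hli
  have hdual : ∀ i : ι, ∃ θ : Module.Dual ℝ V,
      ∀ j ∈ τ, θ (Δ.ray j) = if i = j then 1 else 0 := by
    intro i
    obtain ⟨g, hg⟩ := LinearMap.exists_extend (b.constr ℝ fun j => if i = j.1 then (1 : ℝ) else 0)
    refine ⟨g, fun j hj => ?_⟩
    have h1 : (b ⟨j, hj⟩ : V) = Δ.ray j := Module.Basis.coe_span_apply hli ⟨j, hj⟩
    have h2 := LinearMap.congr_fun hg (b ⟨j, hj⟩)
    rw [Module.Basis.constr_basis] at h2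
    rw [← h1]
    exact h2
  choose θ hθ using hdual
  exact ⟨θ, fun i _ j hj => hθ i j hj⟩

section Maps

variable {ι V : Type*} [Fintype ι] [DecidableEq ι] [AddCommGroup V] [Module ℝ V]

/-- The inclusion of the star of a cone. -/
def starInclusion (Δ : SimplicialFan ι V) (τ : Finset ι) (hτ : τ ∈ Δ.faces) :
    FanMap (Δ.star τ hτ) Δ where
  toLinearMap := LinearMap.id
  coeff := fun i j => if i = j then 1 else 0
  coeff_nonneg := fun i j => by split_ifs <;> simp
  map_ray := fun i _ => by simp [star]
  map_cone := fun σ ⟨γ, hγ, _, hσγ⟩ => ⟨γ, hγ, fun i hi j hij => by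
    have : i = j := by by_contra h; simp [h] at hij
    exact this ▸ hσγ hi⟩

/-- The projection from the star of a cone to its link, induced by `V → V / span τ`. -/
def starProjection (Δ : SimplicialFan ι V) (τ : Finset ι) (hτ : τ ∈ Δ.faces) :
    FanMap (Δ.star τ hτ) (Δ.link τ hτ) where
  toLinearMap := (Δ.coneSpan τ).mkQ
  coeff := fun i j => if i = j ∧ i ∉ τ then 1 else 0
  coeff_nonneg := fun i j => by split_ifs <;> simp
  map_ray := fun i _ => by
    by_cases hi : i ∈ τ
    · have : (Δ.coneSpan τ).mkQ (Δ.ray i) = 0 := by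
        rw [← LinearMap.mem_ker, Submodule.ker_mkQ]
        exact Submodule.subset_span ⟨i, hi, rfl⟩
      simpa [hi, star] using this
    · simp [hi, star, link, ofUnique]
  map_cone := fun σ hσ => ⟨σ \ τ, ⟨(Δ.star τ hτ).down_closed σ hσ _ Finset.sdiff_subset,
    Finset.sdiff_disjoint⟩, fun i hi j hij => by
      have : i = j ∧ i ∉ τ := by by_contra h; simp [h] at hij
      exact Finset.mem_sdiff.mpr ⟨this.1 ▸ hi, this.1 ▸ this.2⟩⟩

/-- The morphism `s` from the star subdivision to `Δ`, given by the identity of `V`. -/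
def subdivisionMap (Δ : SimplicialFan ι V) (τ : Finset ι) (hτ : τ ∈ Δ.faces)
    (hτ2 : τ.card = 2) : FanMap (Δ.starSubdivision τ hτ hτ2) Δ where
  toLinearMap := LinearMap.id
  coeff := fun i j => i.elim (if j ∈ τ then 1 else 0) (fun i => if i = j then 1 else 0)
  coeff_nonneg := fun i j => by cases i <;> simp only [Option.elim] <;> split_ifs <;> simp
  map_ray := fun i _ => by cases i <;> simp [starSubdivision, ofUnique]
  map_cone := fun σ ⟨_, h1, h2⟩ => by
    obtain ⟨γ, hγ, h3, h4⟩ : ∃ γ ∈ Δ.faces, σ.eraseNone ⊆ γ ∧ (none ∈ σ → τ ⊆ γ) := by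
      by_cases hn : none ∈ σ
      · obtain ⟨γ, hγ, h3, h4⟩ := h2 hn
        exact ⟨γ, hγ, h4, fun _ => h3⟩
      · exact ⟨_, h1, subset_rfl, fun h => absurd h hn⟩
    refine ⟨γ, hγ, fun i hi j hij => ?_⟩
    cases i with
    | none =>
      have : j ∈ τ := by by_contra h; simp [h] at hij
      exact h4 hi this
    | some i =>
      have : i = j := by by_contra h; simp [h] at hij
      exact h3 (Finset.mem_eraseNone.mpr (this ▸ hi))

theorem starProjection_pullback_x (Δ : SimplicialFan ι V) (τ : Finset ι) (hτ : τ ∈ Δ.faces)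
    (j : ι) : (Δ.starProjection τ hτ).pullback ((Δ.link τ hτ).x j) =
      if j ∈ τ then 0 else (Δ.star τ hτ).x j := by
  rw [FanMap.pullback_x]
  by_cases hj : j ∈ τ
  · rw [if_pos hj]
    refine Finset.sum_eq_zero fun i _ => ?_
    have : ¬ (i = j ∧ i ∉ τ) := fun h => h.2 (h.1 ▸ hj)
    simp [starProjection, this]
  · rw [if_neg hj, Finset.sum_eq_single j]
    · simp [starProjection, hj]
    · intro i _ hi
      simp [starProjection, hi]
    · simp

/-- The pullback from the link of a cone to its star is an isomorphism of Chow rings. -/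
theorem bijective_starProjection_pullback (Δ : SimplicialFan ι V) (τ : Finset ι)
    (hτ : τ ∈ Δ.faces) : Function.Bijective (Δ.starProjection τ hτ).pullback := by
  obtain ⟨θ, hθ⟩ := Δ.exists_dual hτ
  have hlx : ∀ i ∈ τ, (Δ.link τ hτ).x i = 0 := fun i hi =>
    x_eq_zero _ fun h => Finset.disjoint_left.mp h.2 (Finset.mem_singleton_self i) hi
  have hsray : (Δ.star τ hτ).ray = Δ.ray := rfl
  let y : ι → (Δ.link τ hτ).Chow := fun i =>
    if i ∈ τ then -∑ k, θ i (Δ.ray k) • (Δ.link τ hτ).x k else (Δ.link τ hτ).x i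
  have hy1 : ∀ S : Finset ι, S ∉ (Δ.star τ hτ).faces → ∏ i ∈ S, y i = 0 := by
    intro S hS
    rw [← Finset.prod_sdiff (Finset.inter_subset_left : S ∩ τ ⊆ S), Finset.sdiff_inter_self_left]
    have h : S \ τ ∉ (Δ.link τ hτ).faces := by
      rintro ⟨⟨γ, hγ, h1, h2⟩, -⟩
      refine hS ⟨γ, hγ, h1, fun i hi => ?_⟩
      by_cases hiτ : i ∈ τ
      · exact h1 hiτ
      · exact h2 (Finset.mem_sdiff.mpr ⟨hi, hiτ⟩)
    have h' : ∏ i ∈ S \ τ, y i = ∏ i ∈ S \ τ, (Δ.link τ hτ).x i :=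
      Finset.prod_congr rfl fun i hi => if_neg (Finset.mem_sdiff.mp hi).2
    rw [h', prod_x_eq_zero _ h, zero_mul]
  have hy2 : ∀ φ : Module.Dual ℝ V, ∑ i, φ ((Δ.star τ hτ).ray i) • y i = 0 := by
    intro φ
    rw [hsray]
    let ψ : Module.Dual ℝ V := φ - ∑ i ∈ τ, φ (Δ.ray i) • θ i
    have hψ : Δ.coneSpan τ ≤ LinearMap.ker ψ := by
      refine Submodule.span_le.mpr ?_
      rintro _ ⟨j, hj, rfl⟩
      have hj' : j ∈ τ := hj
      have h : ∑ i ∈ τ, φ (Δ.ray i) * θ i (Δ.ray j) = φ (Δ.ray j) := by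
        rw [Finset.sum_eq_single_of_mem j hj']
        · simp [hθ j hj' j hj']
        · intro i hi hij
          simp [hθ i hi j hj', hij]
      simp [ψ, h]
    have h0 := (Δ.link τ hτ).sum_smul_x_eq_zero ((Δ.coneSpan τ).liftQ ψ hψ)
    have h1 : ∀ i, ((Δ.coneSpan τ).liftQ ψ hψ) ((Δ.link τ hτ).ray i) = ψ (Δ.ray i) :=
      fun i => Submodule.liftQ_apply _ _ _
    simp only [h1, ψ, LinearMap.sub_apply, LinearMap.sum_apply, LinearMap.smul_apply, sub_smul,
      Finset.sum_sub_distrib, Finset.sum_smul, smul_eq_mul] at h0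
    rw [Finset.sum_comm] at h0
    rw [← h0, sub_eq_add_neg, ← Finset.sum_neg_distrib]
    have h2 : ∀ i, φ (Δ.ray i) • y i = φ (Δ.ray i) • (Δ.link τ hτ).x i +
        if i ∈ τ then -∑ k, (φ (Δ.ray i) * θ i (Δ.ray k)) • (Δ.link τ hτ).x k else 0 := by
      intro i
      by_cases hi : i ∈ τ
      · simp only [y, hi, if_true, hlx i hi, smul_zero, zero_add, smul_neg, Finset.smul_sum,
          mul_smul]
      · simp [y, hi]
    simp only [h2, Finset.sum_add_distrib, Finset.sum_ite_mem, Finset.univ_inter]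
  constructor
  · have hleft : ((Δ.star τ hτ).chowLift y hy1 hy2).comp (Δ.starProjection τ hτ).pullback =
        AlgHom.id ℝ _ := by
      refine chow_hom_ext _ fun i => ?_
      rw [AlgHom.comp_apply, starProjection_pullback_x, AlgHom.id_apply]
      by_cases hi : i ∈ τ
      · rw [if_pos hi, map_zero, hlx i hi]
      · rw [if_neg hi, chowLift_x]
        exact if_neg hi
    exact Function.LeftInverse.injective (AlgHom.congr_fun hleft)
  · have hright : (Δ.starProjection τ hτ).pullback.comp ((Δ.star τ hτ).chowLift y hy1 hy2) =
        AlgHom.id ℝ _ := by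
      refine chow_hom_ext _ fun i => ?_
      rw [AlgHom.comp_apply, chowLift_x, AlgHom.id_apply]
      by_cases hi : i ∈ τ
      · have h0 := (Δ.star τ hτ).sum_smul_x_eq_zero (θ i)
        rw [hsray] at h0
        have h3 : ∀ k, θ i (Δ.ray k) • (if k ∈ τ then 0 else (Δ.star τ hτ).x k) =
            θ i (Δ.ray k) • (Δ.star τ hτ).x k - if i = k then (Δ.star τ hτ).x k else 0 := by
          intro k
          by_cases hk : k ∈ τ
          · rw [hθ i hi k hk]
            by_cases hik : i = k <;> simp [hk, hik]
          · have hik : i ≠ k := fun h => hk (h ▸ hi)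
            simp [hk, hik]
        simp only [y, hi, if_true, map_neg, map_sum, map_smul, starProjection_pullback_x, h3,
          Finset.sum_sub_distrib, h0]
        simp
      · simp [y, hi, starProjection_pullback_x]
    exact Function.RightInverse.surjective (AlgHom.congr_fun hright)

/-- The isomorphism of Chow rings from the link of a cone to its star. -/
def linkStarEquiv (Δ : SimplicialFan ι V) (τ : Finset ι) (hτ : τ ∈ Δ.faces) :
    (Δ.link τ hτ).Chow ≃ₐ[ℝ] (Δ.star τ hτ).Chow :=
  AlgEquiv.ofBijective (Δ.starProjection τ hτ).pullback (Δ.bijective_starProjection_pullback τ hτ)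

/-- The restriction `f ↦ f|_{Link τ}` of Chow classes to the link of a cone: restrict to the star,
then apply the inverse of the isomorphism from the link to the star. -/
def restrictLink (Δ : SimplicialFan ι V) (τ : Finset ι) (hτ : τ ∈ Δ.faces) :
    Δ.Chow →ₐ[ℝ] (Δ.link τ hτ).Chow :=
  ((Δ.linkStarEquiv τ hτ).symm : (Δ.star τ hτ).Chow →ₐ[ℝ] (Δ.link τ hτ).Chow).comp
    (Δ.starInclusion τ hτ).pullback

end Maps

/-! ## Minkowski weights and degree maps -/

section Weights

variable {ι V : Type*} [Fintype ι] [DecidableEq ι] [AddCommGroup V] [Module ℝ V]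

open Classical in
/-- `w` is a Minkowski weight of degree `d`: for each cone `ρ` of dimension `d - 1`, the sum of
`w (insert i ρ) • v_i`, over the rays `i` for which `insert i ρ` is a cone of dimension `d`, lies
in the span of `ρ`. Only the values of `w` on the `d`-dimensional cones of `Δ` matter. -/
def IsMinkowskiWeight (Δ : SimplicialFan ι V) (d : ℕ) (w : Finset ι → ℝ) : Prop :=
  ∀ ρ ∈ Δ.faces, ρ.card + 1 = d →
    ∑ i with i ∉ ρ ∧ insert i ρ ∈ Δ.faces, w (insert i ρ) • Δ.ray i ∈ Δ.coneSpan ρ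

/-- The weight on the link of `τ` induced by a weight on `Δ`. -/
def restrictWeight (τ : Finset ι) (w : Finset ι → ℝ) : Finset ι → ℝ :=
  fun σ => w (σ ∪ τ)

/-- The weight on the star subdivision induced by a weight on `Δ`: its value on a maximal cone `σ`
is the value of `w` on the maximal cone of `Δ` that contains `σ`. -/
def subdivisionWeight (τ : Finset ι) (w : Finset ι → ℝ) : Finset (Option ι) → ℝ :=
  fun σ => if none ∈ σ then w (σ.eraseNone ∪ τ) else w σ.eraseNone

/-- The functional `L` on the Chow ring is the degree map of the weight `w`: it maps the monomial
`∏ i ∈ σ, x i` of each `d`-dimensional cone `σ` to `w σ`, and vanishes in degrees other than `d`.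
These conditions determine `L`, since the part of degree `d` of the Chow ring is spanned by the
monomials of the `d`-dimensional cones. -/
def IsDegreeMap {κ W : Type*} [Fintype κ] [AddCommGroup W] [Module ℝ W] (Δ : SimplicialFan κ W)
    (d : ℕ) (w : Finset κ → ℝ) (L : Δ.Chow →ₗ[ℝ] ℝ) : Prop :=
  (∀ σ ∈ Δ.faces, σ.card = d → L (∏ i ∈ σ, Δ.x i) = w σ) ∧
    ∀ k, k ≠ d → ∀ y ∈ Δ.chowDegree k, L y = 0

open Classical in
/-- The degree map `deg_w` of a weight, extended by zero to the whole Chow ring. It exists if and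
only if `w` is a Minkowski weight; otherwise the value here is `0`, for which Poincaré duality
fails. -/
def degreeMap {κ W : Type*} [Fintype κ] [AddCommGroup W] [Module ℝ W] (Δ : SimplicialFan κ W)
    (d : ℕ) (w : Finset κ → ℝ) : Δ.Chow →ₗ[ℝ] ℝ :=
  if h : ∃ L : Δ.Chow →ₗ[ℝ] ℝ, Δ.IsDegreeMap d w L then h.choose else 0

end Weights

end SimplicialFan

end

/-! The core is the blow-up formula: CH(Δ̂) is the direct sum of s*CH(Δ) and a copy x₀·CH(Link τ),
shifted by one. Every class has the form s*a + x₀ s*a', where a is unique and a' is unique modulo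
the kernel of the restriction r to the link (`SimplicialFan.isBlowupDecomposition`). Since τ is not
a cone of Δ̂, (s*x₁ - x₀)(s*x₂ - x₀) = 0, which expresses x₀² through x₀ and 1; this gives spanning.
For uniqueness the expected answer is built by hand (`BlowupAlgebra`): adjoin to CH(Δ) an element ω
with the same quadratic relation and divide by ω·ker r, which is an ideal because x₁x₂ annihilates
ker r. The relations of CH(Δ̂) hold there under x₀ ↦ ω, and in that algebra the coefficients can be
read off.

Multiplication by s*ℓ is diagonal for the decomposition: ℓ on the first summand, r ℓ on the second.
The shift by one and the drop of the top degree from d to d - 2 give both summands the same middle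
degree, so Hard Lefschetz holds summand by summand.

The degree map of Δ̂ applies the degree map of Δ to the coefficient a. In a product of complementary
degrees the cross terms vanish, since the link has nothing in degree d - 1, and x₀² contributes
-deg(x₁x₂a'b'), which is minus the degree on the link. So the pairing is the orthogonal sum of the
pairing of Δ and the negative of that of the link (`IsBlowupDecomposition.deg_mul`). Poincaré
duality follows, and in the Hodge–Riemann relations the minus sign cancels the sign change caused by
the shift. -/

noncomputable section

/-! ### Blow-up decompositions of abstract graded algebras -/

/-- The grading shifted by one: the part of degree `k` is `gr (k - 1)`, or zero for `k = 0`. -/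
def shiftGrading {H : Type*} [CommRing H] [Algebra ℝ H] (gr : ℕ → Submodule ℝ H) :
    ℕ → Submodule ℝ H
  | 0 => ⊥
  | k + 1 => gr k

/-- The graded algebra `B` is generated by `t`, of degree one, as a module over the graded
algebra `A`, and `B` is as a graded `A`-module the direct sum of `A` and of a copy `t C` of the
quotient `C` of `A`, shifted by one. -/
structure IsBlowupDecomposition {A B C : Type*} [CommRing A] [Algebra ℝ A] [CommRing B]
    [Algebra ℝ B] [CommRing C] [Algebra ℝ C] (grA : ℕ → Submodule ℝ A) (grB : ℕ → Submodule ℝ B)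
    (grC : ℕ → Submodule ℝ C) (s : A →ₐ[ℝ] B) (r : A →ₐ[ℝ] C) (t : B) : Prop where
  exists_eq : ∀ k, ∀ b ∈ grB k, ∃ a ∈ grA k, ∃ a' ∈ shiftGrading grA k, b = s a + t * s a'
  add_mem : ∀ k, ∀ a ∈ grA k, ∀ a' ∈ shiftGrading grA k, s a + t * s a' ∈ grB k
  eq_zero_iff : ∀ a a', s a + t * s a' = 0 ↔ a = 0 ∧ r a' = 0
  map_eq : ∀ k, (grA k).map r.toLinearMap = grC k

namespace IsBlowupDecomposition

variable {A B C : Type*} [CommRing A] [Algebra ℝ A] [CommRing B]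
    [Algebra ℝ B] [CommRing C] [Algebra ℝ C] {grA : ℕ → Submodule ℝ A} {grB : ℕ → Submodule ℝ B}
    {grC : ℕ → Submodule ℝ C} {s : A →ₐ[ℝ] B} {r : A →ₐ[ℝ] C} {t : B}

theorem map_mem (h : IsBlowupDecomposition grA grB grC s r t) {k : ℕ} {a : A} (ha : a ∈ grA k) :
    r a ∈ grC k :=
  h.map_eq k ▸ Submodule.mem_map_of_mem ha

theorem exists_map_eq (h : IsBlowupDecomposition grA grB grC s r t) {k : ℕ} {c : C}
    (hc : c ∈ grC k) : ∃ a ∈ grA k, r a = c := by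
  rw [← h.map_eq k] at hc
  exact hc

theorem mul_map_eq_zero_iff (h : IsBlowupDecomposition grA grB grC s r t) (a : A) :
    t * s a = 0 ↔ r a = 0 := by
  simpa using h.eq_zero_iff 0 a

theorem mul_congr (h : IsBlowupDecomposition grA grB grC s r t) {a a' : A} (haa' : r a = r a') :
    t * s a = t * s a' := by
  rw [← sub_eq_zero, ← mul_sub, ← map_sub, h.mul_map_eq_zero_iff, map_sub, haa', sub_self]

theorem eq_iff (h : IsBlowupDecomposition grA grB grC s r t) {a a' b b' : A} :
    s a + t * s a' = s b + t * s b' ↔ a = b ∧ r a' = r b' := by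
  have := h.eq_zero_iff (a - b) (a' - b')
  rw [map_sub, map_sub, map_sub, sub_eq_zero, sub_eq_zero (a := r a')] at this
  rw [← this, ← sub_eq_zero]
  ring_nf

/-- In degrees where the shifted copy of `C` vanishes, `B` agrees with `A`. -/
theorem exists_eq_map (h : IsBlowupDecomposition grA grB grC s r t) {k : ℕ}
    (hC : grC (k - 1) = ⊥) {b : B} (hb : b ∈ grB k) : ∃ a ∈ grA k, b = s a := by
  obtain ⟨a, ha, a', ha', rfl⟩ := h.exists_eq k b hb
  refine ⟨a, ha, ?_⟩
  cases k with
  | zero =>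
    rw [(Submodule.mem_bot ℝ).mp ha']
    simp
  | succ k =>
    have : r a' ∈ grC k := h.map_mem ha'
    rw [Nat.add_sub_cancel] at hC
    rw [hC, Submodule.mem_bot] at this
    rw [(h.mul_map_eq_zero_iff a').mpr this, add_zero]

theorem map_mem_left (h : IsBlowupDecomposition grA grB grC s r t) {k : ℕ} {a : A}
    (ha : a ∈ grA k) : s a ∈ grB k := by
  simpa using h.add_mem k a ha 0 (zero_mem _)

/-- `s ℓ` acts by `ℓ` on the summand `A` and by `r ℓ` on the summand `C`. Since d - 2i = (d - 2) -
2(i - 1), the map on the second summand in degree i is the Lefschetz map of `C` in degree i - 1. For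
i = 0 the second summand vanishes in degree 0 by definition and in degree d because `C` has no part
of degree d - 1. -/
theorem hardLefschetz [SetLike.GradedMonoid grA] (h : IsBlowupDecomposition grA grB grC s r t)
    {d : ℕ} (hd : 2 ≤ d) (hC : ∀ k, d - 2 < k → grC k = ⊥) {ℓ : A} (hℓ : ℓ ∈ grA 1)
    (hA : SatisfiesHardLefschetz grA d ℓ) (hL : SatisfiesHardLefschetz grC (d - 2) (r ℓ)) :
    SatisfiesHardLefschetz grB d (s ℓ) := by
  have hmul : ∀ (n : ℕ) (a a' : A),
      s ℓ ^ n * (s a + t * s a') = s (ℓ ^ n * a) + t * s (ℓ ^ n * a') := by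
    intro n a a'
    simp only [map_mul, map_pow]
    ring
  have hpow : ∀ (n k : ℕ), ∀ a ∈ grA k, ℓ ^ n * a ∈ grA (n + k) := by
    intro n k a ha
    have := SetLike.mul_mem_graded (SetLike.pow_mem_graded n hℓ) ha
    simpa using this
  intro i hi
  refine ⟨fun b hb => ?_, fun b hb b' hb' hbb' => ?_, fun b hb => ?_⟩
  · obtain ⟨a, ha, a', ha', rfl⟩ := h.exists_eq i b hb
    change s ℓ ^ _ * _ ∈ grB (d - i)
    rw [hmul]
    refine h.add_mem _ _ ((hA i hi).mapsTo ha) _ ?_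
    cases i with
    | zero =>
      rw [(Submodule.mem_bot ℝ).mp ha', mul_zero]
      exact zero_mem _
    | succ i =>
      -- The target degree is written as a successor so that `shiftGrading` unfolds.
      have h1 : d - (i + 1) = (d - 2 * (i + 1) + i) + 1 := by omega
      rw [h1]
      exact hpow _ _ _ ha'
  · obtain ⟨a, ha, a', ha', rfl⟩ := h.exists_eq i b hb
    obtain ⟨c, hc, c', hc', rfl⟩ := h.exists_eq i b' hb'
    simp only [hmul] at hbb'
    obtain ⟨h1, h2⟩ := h.eq_iff.mp hbb'
    rw [(hA i hi).injOn ha hc h1]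
    congr 1
    cases i with
    | zero => rw [(Submodule.mem_bot ℝ).mp ha', (Submodule.mem_bot ℝ).mp hc']
    | succ i =>
      have h3 : d - 2 * (i + 1) = d - 2 - 2 * i := by omega
      rw [map_mul, map_mul, map_pow, h3] at h2
      exact h.mul_congr ((hL i (by omega)).injOn (h.map_mem ha') (h.map_mem hc') h2)
  · obtain ⟨a, ha, a', ha', rfl⟩ := h.exists_eq _ b hb
    obtain ⟨c, hc, rfl⟩ := (hA i hi).surjOn ha
    cases i with
    | zero =>
      -- Here `b` has degree d, where the second summand is a copy of the part of `C` of degree d -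
      -- 1, hence zero.
      obtain ⟨e, he, he'⟩ := h.exists_eq_map (hC _ (by omega)) hb
      obtain ⟨c, hc, rfl⟩ := (hA 0 hi).surjOn he
      refine ⟨s c, h.map_mem_left hc, ?_⟩
      simpa using he'.symm
    | succ i =>
      have h1 : d - (i + 1) = (d - 2 - i) + 1 := by omega
      have h3 : d - 2 * (i + 1) = d - 2 - 2 * i := by omega
      rw [h1] at ha'
      obtain ⟨z, hz, hz'⟩ := (hL i (by omega)).surjOn (h.map_mem ha')
      obtain ⟨c', hc', rfl⟩ := h.exists_map_eq hz
      refine ⟨s c + t * s c', h.add_mem _ c hc c' hc', ?_⟩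
      simp only [hmul]
      refine h.eq_iff.mpr ⟨rfl, ?_⟩
      rw [map_mul, map_pow, h3]
      exact hz'

theorem mul_mem_shiftGrading [SetLike.GradedMonoid grA] {i j : ℕ} {a b : A} (ha : a ∈ grA i)
    (hb : b ∈ shiftGrading grA j) : a * b ∈ shiftGrading grA (i + j) := by
  cases j with
  | zero =>
    rw [(Submodule.mem_bot ℝ).mp hb, mul_zero]
    exact zero_mem _
  | succ j => exact SetLike.mul_mem_graded (A := grA) ha hb

theorem mul_mem_of_mem_shiftGrading [SetLike.GradedMonoid grA] {i : ℕ} {e a : A} (he : e ∈ grA 1)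
    (ha : a ∈ shiftGrading grA i) : e * a ∈ grA i := by
  have h := mul_mem_shiftGrading he ha
  rwa [add_comm] at h

/-- The degree form of `B` is the orthogonal sum of the degree form of `A` and of minus the degree
form of `C`. -/
theorem deg_mul [SetLike.GradedMonoid grA] (h : IsBlowupDecomposition grA grB grC s r t)
    {d : ℕ} (hd : 2 ≤ d) {degA : A →ₗ[ℝ] ℝ} {degB : B →ₗ[ℝ] ℝ}
    {degC : C →ₗ[ℝ] ℝ} {e₁ e₂ : A} (he₁ : e₁ ∈ grA 1) (he₂ : e₂ ∈ grA 2)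
    (ht : t ^ 2 = s e₁ * t - s e₂) (hB : ∀ a ∈ grA d, degB (s a) = degA a)
    (hC : grC (d - 1) = ⊥) (hAC : ∀ a ∈ grA (d - 2), degA (e₂ * a) = degC (r a))
    {i j : ℕ} (hij : i + j = d) {a b a' b' : A} (ha : a ∈ grA i)
    (hb : b ∈ grA j) (ha' : a' ∈ shiftGrading grA i) (hb' : b' ∈ shiftGrading grA j) :
    degB ((s a + t * s a') * (s b + t * s b')) = degA (a * b) - degC (r a' * r b') := by
  -- Normal form of the product after substituting e₁t - e₂ for t²: the sign of the `C` part
  -- originates in -e₂.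
  have h1 : (s a + t * s a') * (s b + t * s b') = s (a * b) - s (e₂ * (a' * b')) +
      t * s (a * b' + b * a' + e₁ * a' * b') := by
    simp only [map_mul, map_add]
    linear_combination (s a' * s b') * ht
  have h2 : a * b' + b * a' + e₁ * a' * b' ∈ shiftGrading grA (i + j) :=
    Submodule.add_mem _ (Submodule.add_mem _ (mul_mem_shiftGrading ha hb')
      (add_comm i j ▸ mul_mem_shiftGrading hb ha'))
      (mul_mem_shiftGrading (mul_mem_of_mem_shiftGrading he₁ ha') hb')
  -- The coefficient of `t` has degree d - 1, where `C` is zero; this is the orthogonality of the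
  -- two summands.
  have h3 : r (a * b' + b * a' + e₁ * a' * b') = 0 := by
    rw [hij, show d = (d - 1) + 1 by omega] at h2
    have := h.map_mem (k := d - 1) h2
    rwa [hC, Submodule.mem_bot] at this
  have h4 : a' * b' ∈ grA (d - 2) := by
    cases i with
    | zero =>
      rw [(Submodule.mem_bot ℝ).mp ha', zero_mul]
      exact zero_mem _
    | succ i =>
      have := mul_mem_shiftGrading (i := i) ha' hb'
      rw [show i + j = (d - 2) + 1 by omega] at this
      exact this
  have h5 : a * b ∈ grA d := hij ▸ SetLike.mul_mem_graded ha hb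
  have h6 : e₂ * (a' * b') ∈ grA d := by
    have := SetLike.mul_mem_graded he₂ h4
    rwa [Nat.add_sub_cancel' hd] at this
  rw [h1, (h.mul_map_eq_zero_iff _).mpr h3, add_zero, LinearMap.map_sub, hB _ h5, hB _ h6,
    hAC _ h4, map_mul r]

/-- By `deg_mul` the pairing is an orthogonal sum of two non-degenerate ones, a sign on the second
being harmless. In degree d only `A` contributes, so `degB` inherits bijectivity from `degA`. -/
theorem poincareDuality [SetLike.GradedMonoid grA] (h : IsBlowupDecomposition grA grB grC s r t)
    {d : ℕ} (hd : 2 ≤ d) {degA : A →ₗ[ℝ] ℝ} {degB : B →ₗ[ℝ] ℝ}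
    {degC : C →ₗ[ℝ] ℝ} {e₁ e₂ : A} (he₁ : e₁ ∈ grA 1) (he₂ : e₂ ∈ grA 2)
    (ht : t ^ 2 = s e₁ * t - s e₂) (hB : ∀ a ∈ grA d, degB (s a) = degA a)
    (hAC : ∀ a ∈ grA (d - 2), degA (e₂ * a) = degC (r a))
    (hA : SatisfiesPoincareDuality grA d degA) (hC : SatisfiesPoincareDuality grC (d - 2) degC) :
    SatisfiesPoincareDuality grB d degB where
  eq_bot i hi := by
    rw [eq_bot_iff]
    intro b hb
    obtain ⟨a, ha, rfl⟩ := h.exists_eq_map (hC.eq_bot _ (by omega)) hb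
    rw [hA.eq_bot i hi, Submodule.mem_bot] at ha
    simp [ha]
  bijective_deg := by
    have hC' : grC (d - 1) = ⊥ := hC.eq_bot _ (by omega)
    constructor
    · rw [← LinearMap.ker_eq_bot, LinearMap.ker_eq_bot']
      rintro ⟨b, hb⟩ hb'
      obtain ⟨a, ha, rfl⟩ := h.exists_eq_map hC' hb
      have h1 : degA a = 0 := by
        rw [← hB a ha]
        exact hb'
      have h2 : (⟨a, ha⟩ : grA d) = 0 := hA.bijective_deg.1 (by simpa using h1)
      have h3 : a = 0 := congrArg Subtype.val h2
      simp [h3]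
    · intro y
      obtain ⟨⟨a, ha⟩, hy⟩ := hA.bijective_deg.2 y
      exact ⟨⟨s a, h.map_mem_left ha⟩, (hB a ha).trans hy⟩
  nondegenerate := by
    have hC' : grC (d - 1) = ⊥ := hC.eq_bot _ (by omega)
    intro i j hij b hb hort
    obtain ⟨a, ha, a', ha', rfl⟩ := h.exists_eq i b hb
    have key : ∀ y ∈ grA j, ∀ y' ∈ shiftGrading grA j,
        degA (a * y) - degC (r a' * r y') = 0 := fun y hy y' hy' => by
      rw [← h.deg_mul hd he₁ he₂ ht hB hC' hAC hij ha hy ha' hy']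
      exact hort _ (h.add_mem j y hy y' hy')
    refine (h.eq_zero_iff a a').mpr ⟨hA.nondegenerate i j hij a ha fun y hy => ?_, ?_⟩
    · simpa using key y hy 0 (zero_mem _)
    · cases i with
      | zero => rw [(Submodule.mem_bot ℝ).mp ha', map_zero]
      | succ i =>
        have hr : r a' ∈ grC i := h.map_mem ha'
        cases j with
        -- With j = 0 there is no partner in `C` to test against, but the class then lies in degree
        -- d - 1 of `C`, which is zero.
        | zero => rwa [show i = d - 1 by omega, hC', Submodule.mem_bot] at hr
        | succ j =>
          refine hC.nondegenerate i j (by omega) _ hr fun c hc => ?_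
          obtain ⟨y', hy', rfl⟩ := h.exists_map_eq hc
          simpa using key 0 (zero_mem _) y' hy'

/-- A primitive element is a pair of primitive elements, of degree i in `A` and i - 1 in `C`,
because `s ℓ` acts diagonally. The form is the difference of the two Lefschetz forms, and -(-1)^i =
(-1)^(i-1) is the sign that Hodge–Riemann for `C` requires. -/
theorem hodgeRiemann [SetLike.GradedMonoid grA] (h : IsBlowupDecomposition grA grB grC s r t)
    {d : ℕ} (hd : 2 ≤ d) {degA : A →ₗ[ℝ] ℝ} {degB : B →ₗ[ℝ] ℝ}
    {degC : C →ₗ[ℝ] ℝ} {e₁ e₂ : A} (he₁ : e₁ ∈ grA 1) (he₂ : e₂ ∈ grA 2)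
    (ht : t ^ 2 = s e₁ * t - s e₂) (hB : ∀ a ∈ grA d, degB (s a) = degA a)
    (hC : grC (d - 1) = ⊥) (hAC : ∀ a ∈ grA (d - 2), degA (e₂ * a) = degC (r a))
    {ℓ : A} (hℓ : ℓ ∈ grA 1) (hA : SatisfiesHodgeRiemann grA d degA ℓ)
    (hL : SatisfiesHodgeRiemann grC (d - 2) degC (r ℓ)) :
    SatisfiesHodgeRiemann grB d degB (s ℓ) := by
  intro i hi b hb hb0
  obtain ⟨hb1, hb2⟩ := hb
  obtain ⟨a, ha, a', ha', rfl⟩ := h.exists_eq i b hb1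
  have hpow : ∀ n, ℓ ^ n ∈ grA n := fun n => by
    simpa using SetLike.pow_mem_graded n hℓ
  have hmul : ∀ (n : ℕ),
      s ℓ ^ n * (s a + t * s a') = s (ℓ ^ n * a) + t * s (ℓ ^ n * a') := by
    intro n
    simp only [map_mul, map_pow]
    ring
  rw [SetLike.mem_coe, LinearMap.mem_ker, LinearMap.mulLeft_apply, hmul, h.eq_zero_iff, map_mul, map_pow] at hb2
  have hj : d - 2 * i + i = d - i := by omega
  have hform : lefschetzForm d degB (s ℓ) i (s a + t * s a') (s a + t * s a') =
      lefschetzForm d degA ℓ i a a - degC (r a' * (r ℓ ^ (d - 2 * i) * r a')) := by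
    rw [lefschetzForm, hmul, h.deg_mul hd he₁ he₂ ht hB hC hAC (Nat.add_sub_cancel' (by omega))
      ha (hj ▸ SetLike.mul_mem_graded (hpow _) ha) ha' (hj ▸ mul_mem_shiftGrading (hpow _) ha'),
      map_mul r, map_pow, lefschetzForm]
  have hApos : a ≠ 0 → 0 < (-1 : ℝ) ^ i * lefschetzForm d degA ℓ i a a :=
    hA i hi a ⟨ha, hb2.1⟩
  have hA0 : a = 0 → lefschetzForm d degA ℓ i a a = 0 := by
    rintro rfl
    simp [lefschetzForm]
  have hCpos : r a' ≠ 0 →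
      0 < -((-1 : ℝ) ^ i * degC (r a' * (r ℓ ^ (d - 2 * i) * r a'))) := by
    intro h0
    cases i with
    | zero =>
      rw [(Submodule.mem_bot ℝ).mp ha', map_zero] at h0
      exact absurd rfl h0
    | succ i =>
      have h3 : d - 2 * (i + 1) = d - 2 - 2 * i := by omega
      rw [h3] at hb2 ⊢
      have := hL i (by omega) (r a') ⟨h.map_mem ha', hb2.2⟩ h0
      rw [lefschetzForm] at this
      rw [pow_succ]
      linarith
  have hne : a ≠ 0 ∨ r a' ≠ 0 := by
    by_contra! hcon
    exact hb0 ((h.eq_zero_iff a a').mpr hcon)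
  rw [hform, mul_sub, sub_eq_add_neg]
  by_cases h0 : r a' = 0
  · have h1 : a ≠ 0 := hne.resolve_right (not_not.mpr h0)
    simpa [h0] using hApos h1
  · by_cases h1 : a = 0
    · rw [hA0 h1, mul_zero, zero_add]
      exact hCpos h0
    · exact add_pos (hApos h1) (hCpos h0)

end IsBlowupDecomposition
end

/-! ### The model algebra: a quadratic extension modulo ω·ker r -/

noncomputable section

section BlowupAlgebra

variable {A C : Type*} [CommRing A] [Algebra ℝ A] [CommRing C] [Algebra ℝ C] (r : A →ₐ[ℝ] C)
  (e₁ e₂ : A) (h : ∀ a, r a = 0 → e₂ * a = 0)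

/-- The multiples `a' ω`, `r a' = 0`, in the algebra obtained from `A` by adjoining an element `ω`
with `ω ^ 2 = e₁ * ω - e₂`. -/
def blowupIdeal : Ideal (QuadraticAlgebra A (-e₂) e₁) where
  carrier := {z | z.re = 0 ∧ r z.im = 0}
  zero_mem' := by simp
  add_mem' := by
    rintro a b ⟨ha, ha'⟩ ⟨hb, hb'⟩
    simp [ha, ha', hb, hb']
  smul_mem' := by
    rintro c a ⟨ha, ha'⟩
    -- Multiplying a'ω by a multiple of ω produces, through ω², the constant term -e₂·c.im·a'. It
    -- has to vanish, which is why `e₂` must annihilate the kernel of `r`.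
    have h' : e₂ * (c.im * a.im) = 0 := h _ (by rw [map_mul, ha', mul_zero])
    constructor
    · simp [ha, mul_assoc, h']
    · simp [ha, ha']

/-- The algebra obtained from `A` by adjoining an element `ω` with `ω ^ 2 = e₁ * ω - e₂`
that annihilates the kernel of `r`. -/
def BlowupAlgebra : Type _ :=
  QuadraticAlgebra A (-e₂) e₁ ⧸ blowupIdeal r e₁ e₂ h

namespace BlowupAlgebra

instance : CommRing (BlowupAlgebra r e₁ e₂ h) :=
  inferInstanceAs (CommRing (QuadraticAlgebra A (-e₂) e₁ ⧸ blowupIdeal r e₁ e₂ h))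

instance : Algebra ℝ (BlowupAlgebra r e₁ e₂ h) :=
  inferInstanceAs (Algebra ℝ (QuadraticAlgebra A (-e₂) e₁ ⧸ blowupIdeal r e₁ e₂ h))

/-- The quotient map. -/
def mk : QuadraticAlgebra A (-e₂) e₁ →ₐ[ℝ] BlowupAlgebra r e₁ e₂ h :=
  Ideal.Quotient.mkₐ ℝ (blowupIdeal r e₁ e₂ h)

theorem mk_eq_zero_iff (z : QuadraticAlgebra A (-e₂) e₁) :
    mk r e₁ e₂ h z = 0 ↔ z.re = 0 ∧ r z.im = 0 :=
  Ideal.Quotient.eq_zero_iff_mem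

/-- The map from `A` to the algebra obtained by adjoining `ω`. -/
def of : A →ₐ[ℝ] BlowupAlgebra r e₁ e₂ h :=
  (mk r e₁ e₂ h).comp (IsScalarTower.toAlgHom ℝ A (QuadraticAlgebra A (-e₂) e₁))

/-- The adjoined element. -/
def omega : BlowupAlgebra r e₁ e₂ h :=
  mk r e₁ e₂ h QuadraticAlgebra.omega

theorem of_add_omega_mul (a a' : A) :
    of r e₁ e₂ h a + omega r e₁ e₂ h * of r e₁ e₂ h a' = mk r e₁ e₂ h ⟨a, a'⟩ := by
  rw [of, omega, AlgHom.comp_apply, AlgHom.comp_apply, ← map_mul, ← map_add]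
  congr 1
  ext <;> simp

theorem of_add_omega_mul_eq_zero_iff (a a' : A) :
    of r e₁ e₂ h a + omega r e₁ e₂ h * of r e₁ e₂ h a' = 0 ↔ a = 0 ∧ r a' = 0 := by
  rw [of_add_omega_mul, mk_eq_zero_iff]

theorem omega_mul_of_eq_zero {a : A} (ha : r a = 0) :
    omega r e₁ e₂ h * of r e₁ e₂ h a = 0 := by
  simpa [ha] using of_add_omega_mul_eq_zero_iff r e₁ e₂ h 0 a

theorem omega_sq :
    omega r e₁ e₂ h ^ 2 = of r e₁ e₂ h e₁ * omega r e₁ e₂ h - of r e₁ e₂ h e₂ := by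
  rw [of, omega, AlgHom.comp_apply, AlgHom.comp_apply, ← map_mul, ← map_sub, ← map_pow, sq]
  congr 1
  ext <;> simp

/-- The coefficient of `1` with respect to the generators `1` and `ω`. -/
def re : BlowupAlgebra r e₁ e₂ h →ₗ[ℝ] A :=
  ((blowupIdeal r e₁ e₂ h).restrictScalars ℝ).liftQ
    { toFun := fun z => z.re, map_add' := fun _ _ => rfl, map_smul' := fun _ _ => rfl }
    (fun _ hz => hz.1) ∘ₗ
  (Submodule.Quotient.restrictScalarsEquiv ℝ (blowupIdeal r e₁ e₂ h)).symm.toLinearMap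

theorem re_of_add_omega_mul (a a' : A) :
    re r e₁ e₂ h (of r e₁ e₂ h a + omega r e₁ e₂ h * of r e₁ e₂ h a') = a := by
  rw [of_add_omega_mul]
  rfl

end BlowupAlgebra

end BlowupAlgebra
end

/-! ### Grading of the Chow ring and uniqueness of degree maps -/

noncomputable section
namespace SimplicialFan

section Grading

open MvPolynomial

variable {ι V : Type*} [Fintype ι] [AddCommGroup V] [Module ℝ V]

theorem chowDegree_one (Δ : SimplicialFan ι V) :
    Δ.chowDegree 1 = Submodule.span ℝ (Set.range Δ.x) := by
  rw [chowDegree, homogeneousSubmodule_one_eq_span_X, Submodule.map_span, ← Set.range_comp]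
  rfl

/-- The Chow ring is generated in degree one. In this form, multiplicativity of the grading and its
behaviour under algebra homomorphisms reduce to degree one. -/
theorem chowDegree_eq_pow (Δ : SimplicialFan ι V) (k : ℕ) :
    Δ.chowDegree k = Submodule.span ℝ (Set.range Δ.x) ^ k := by
  rw [← chowDegree_one, chowDegree, ← homogeneousSubmodule_one_pow, Submodule.map_pow, chowDegree]

theorem chowDegree_zero (Δ : SimplicialFan ι V) : Δ.chowDegree 0 = 1 :=
  (Δ.chowDegree_eq_pow 0).trans (Submodule.pow_zero _)

theorem chowDegree_add (Δ : SimplicialFan ι V) (i j : ℕ) :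
    Δ.chowDegree (i + j) = Δ.chowDegree i * Δ.chowDegree j := by
  rw [chowDegree_eq_pow, chowDegree_eq_pow, chowDegree_eq_pow]
  exact pow_add (Submodule.span ℝ (Set.range Δ.x)) i j

instance (Δ : SimplicialFan ι V) : SetLike.GradedMonoid Δ.chowDegree where
  one_mem := by
    rw [chowDegree_zero]
    exact Submodule.one_le.mp le_rfl
  mul_mem i j a b ha hb := by
    rw [chowDegree_add]
    exact Submodule.mul_mem_mul ha hb

theorem x_mem_chowDegree (Δ : SimplicialFan ι V) (i : ι) : Δ.x i ∈ Δ.chowDegree 1 := by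
  rw [chowDegree_one]
  exact Submodule.subset_span ⟨i, rfl⟩

theorem prod_x_mem_chowDegree (Δ : SimplicialFan ι V) (σ : Finset ι) :
    ∏ i ∈ σ, Δ.x i ∈ Δ.chowDegree σ.card := by
  classical
  induction σ using Finset.induction_on with
  | empty => simpa using SetLike.one_mem_graded Δ.chowDegree
  | insert i σ hi ih =>
    rw [Finset.prod_insert hi, Finset.card_insert_of_notMem hi, add_comm]
    exact SetLike.mul_mem_graded (Δ.x_mem_chowDegree i) ih

theorem chowDegree_zero_le (Δ : SimplicialFan ι V) {M : Submodule ℝ Δ.Chow} (h : 1 ∈ M) :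
    Δ.chowDegree 0 ≤ M := by
  rw [chowDegree_zero]
  exact Submodule.one_le.mpr h

/-- The induction step for statements about all degrees: only multiplication by a single generator
has to be controlled. -/
theorem chowDegree_succ_le (Δ : SimplicialFan ι V) {k : ℕ} {M : Submodule ℝ Δ.Chow}
    (h : ∀ i, ∀ y ∈ Δ.chowDegree k, Δ.x i * y ∈ M) : Δ.chowDegree (k + 1) ≤ M := by
  rw [add_comm, chowDegree_add, chowDegree_one, Submodule.mul_le]
  intro a ha y hy
  induction ha using Submodule.span_induction with
  | mem a ha =>
    obtain ⟨i, rfl⟩ := ha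
    exact h i y hy
  | zero => simp
  | add a b _ _ ha hb =>
    rw [add_mul]
    exact add_mem ha hb
  | smul c a _ ha =>
    rw [smul_mul_assoc]
    exact M.smul_mem c ha

/-- The image of the grading under a surjection that maps degree one onto degree one. -/
theorem map_chowDegree_eq {κ W : Type*} [Fintype κ] [AddCommGroup W] [Module ℝ W]
    {Δ : SimplicialFan ι V} {Γ : SimplicialFan κ W} (f : Δ.Chow →ₐ[ℝ] Γ.Chow)
    (h1 : ∀ i, f (Δ.x i) ∈ Γ.chowDegree 1)
    (h2 : ∀ j, Γ.x j ∈ (Δ.chowDegree 1).map f.toLinearMap) (k : ℕ) :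
    (Δ.chowDegree k).map f.toLinearMap = Γ.chowDegree k := by
  have h : (Δ.chowDegree 1).map f.toLinearMap = Γ.chowDegree 1 := by
    apply le_antisymm
    · rw [chowDegree_one Δ, Submodule.map_span, Submodule.span_le]
      rintro _ ⟨_, ⟨i, rfl⟩, rfl⟩
      exact h1 i
    · rw [chowDegree_one Γ, Submodule.span_le]
      rintro _ ⟨j, rfl⟩
      exact h2 j
  rw [chowDegree_eq_pow, chowDegree_eq_pow, Submodule.map_pow, ← chowDegree_one, h, chowDegree_one]

theorem map_mem_chowDegree {κ W : Type*} [Fintype κ] [AddCommGroup W] [Module ℝ W]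
    {Δ : SimplicialFan ι V} {Γ : SimplicialFan κ W} (f : Δ.Chow →ₐ[ℝ] Γ.Chow)
    (h1 : ∀ i, f (Δ.x i) ∈ Γ.chowDegree 1) {k : ℕ} {a : Δ.Chow} (ha : a ∈ Δ.chowDegree k) :
    f a ∈ Γ.chowDegree k := by
  have h : (Δ.chowDegree 1).map f.toLinearMap ≤ Γ.chowDegree 1 := by
    rw [chowDegree_one Δ, Submodule.map_span, Submodule.span_le]
    rintro _ ⟨_, ⟨i, rfl⟩, rfl⟩
    exact h1 i
  have h' : (Δ.chowDegree k).map f.toLinearMap ≤ Γ.chowDegree k := by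
    rw [chowDegree_eq_pow, chowDegree_eq_pow, Submodule.map_pow, ← chowDegree_one,
      ← chowDegree_one]
    exact pow_le_pow_left' h k
  exact h' (Submodule.mem_map_of_mem ha)

/-- A generator of a cone, as a combination of generators outside of the cone. -/
theorem exists_x_eq [DecidableEq ι] (Δ : SimplicialFan ι V) {σ : Finset ι} (hσ : σ ∈ Δ.faces)
    {i : ι} (hi : i ∈ σ) :
    ∃ c : ι → ℝ, (∀ j ∈ σ, c j = 0) ∧ Δ.x i = ∑ j, c j • Δ.x j := by
  obtain ⟨θ, hθ⟩ := Δ.exists_dual hσ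
  refine ⟨fun j => if j ∈ σ then 0 else -θ i (Δ.ray j), fun j hj => if_pos hj, ?_⟩
  have h := Δ.sum_smul_x_eq_zero (θ i)
  have h' : ∀ j, θ i (Δ.ray j) • Δ.x j = (if i = j then Δ.x j else 0) -
      (if j ∈ σ then 0 else -θ i (Δ.ray j)) • Δ.x j := by
    intro j
    by_cases hj : j ∈ σ
    · rw [hθ i hi j hj]
      simp [hj]
    · have : i ≠ j := fun h => hj (h ▸ hi)
      simp [hj, this]
  simp only [h', Finset.sum_sub_distrib, Finset.sum_ite_eq, Finset.mem_univ, if_true] at h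
  exact sub_eq_zero.mp h

/-- The square-free monomials of the cones of dimension `k` span the part of degree `k`. -/
theorem chowDegree_le_span (Δ : SimplicialFan ι V) (k : ℕ) :
    Δ.chowDegree k ≤
      Submodule.span ℝ {y | ∃ σ ∈ Δ.faces, σ.card = k ∧ y = ∏ i ∈ σ, Δ.x i} := by
  classical
  -- Induction on the degree j of the cofactor of a square-free monomial, for all σ at once, because
  -- each step enlarges σ by one ray. The claim is the case σ = ∅.
  have key : ∀ (j : ℕ) (σ : Finset ι), Δ.chowDegree j ≤ Submodule.comap
      (LinearMap.mulLeft ℝ (∏ i ∈ σ, Δ.x i)) (Submodule.span ℝ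
        {y | ∃ ρ ∈ Δ.faces, ρ.card = σ.card + j ∧ y = ∏ i ∈ ρ, Δ.x i}) := by
    intro j
    induction j with
    | zero =>
      intro σ
      refine Δ.chowDegree_zero_le ?_
      rw [Submodule.mem_comap, LinearMap.mulLeft_apply, mul_one]
      by_cases hσ : σ ∈ Δ.faces
      · exact Submodule.subset_span ⟨σ, hσ, rfl, rfl⟩
      · rw [Δ.prod_x_eq_zero hσ]
        exact zero_mem _
    | succ j ih =>
      intro σ
      refine Δ.chowDegree_succ_le ?_
      intro i y hy
      rw [Submodule.mem_comap, LinearMap.mulLeft_apply, ← mul_assoc]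
      have hout : ∀ l, l ∉ σ → (∏ i ∈ σ, Δ.x i) * Δ.x l * y ∈ Submodule.span ℝ
          {y | ∃ ρ ∈ Δ.faces, ρ.card = σ.card + (j + 1) ∧ y = ∏ i ∈ ρ, Δ.x i} := by
        intro l hl
        have := ih (insert l σ) hy
        rwa [Submodule.mem_comap, LinearMap.mulLeft_apply, Finset.prod_insert hl, Finset.card_insert_of_notMem hl, mul_comm (Δ.x l),
          add_assoc, add_comm 1] at this
      by_cases hi : i ∈ σ
      · by_cases hσ : σ ∈ Δ.faces
        -- A repeated variable is traded, by a linear relation, for variables outside σ.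
        · obtain ⟨c, hc, hx⟩ := Δ.exists_x_eq hσ hi
          rw [hx, Finset.mul_sum, Finset.sum_mul]
          refine Submodule.sum_mem _ fun l _ => ?_
          by_cases hl : l ∈ σ
          · simp [hc l hl]
          · rw [mul_smul_comm, smul_mul_assoc]
            exact Submodule.smul_mem _ _ (hout l hl)
        · rw [Δ.prod_x_eq_zero hσ, zero_mul, zero_mul]
          exact zero_mem _
      · exact hout i hi
  intro y hy
  simpa using key k ∅ hy

theorem chowDegree_eq_bot (Δ : SimplicialFan ι V) {k : ℕ}
    (h : ∀ σ ∈ Δ.faces, σ.card < k) : Δ.chowDegree k = ⊥ := by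
  rw [eq_bot_iff]
  refine (Δ.chowDegree_le_span k).trans (Submodule.span_le.mpr ?_)
  rintro _ ⟨σ, hσ, hk, -⟩
  exact absurd hk (h σ hσ).ne

theorem IsPure.card_le {Δ : SimplicialFan ι V} {d : ℕ} (hd : Δ.IsPure d) {σ : Finset ι}
    (hσ : σ ∈ Δ.faces) : σ.card ≤ d := by
  obtain ⟨ρ, hσρ, hρ⟩ := (Set.toFinite Δ.faces).exists_le_maximal hσ
  rw [← hd ρ hρ.prop fun γ hγ h => (hρ.eq_of_le hγ h).symm]
  exact Finset.card_le_card hσρ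

/-- A degree map is determined in degree `d` by the weight. -/
theorem IsDegreeMap.eq_of_mem {Δ : SimplicialFan ι V} {d : ℕ} {w : Finset ι → ℝ}
    {L L' : Δ.Chow →ₗ[ℝ] ℝ} (h : Δ.IsDegreeMap d w L) (h' : Δ.IsDegreeMap d w L') {y : Δ.Chow}
    (hy : y ∈ Δ.chowDegree d) : L y = L' y := by
  have : Δ.chowDegree d ≤ LinearMap.eqLocus L L' := by
    refine (Δ.chowDegree_le_span d).trans (Submodule.span_le.mpr ?_)
    rintro _ ⟨σ, hσ, hk, rfl⟩
    exact (h.1 σ hσ hk).trans (h'.1 σ hσ hk).symm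
  exact this hy

theorem IsDegreeMap.degreeMap {Δ : SimplicialFan ι V} {d : ℕ} {w : Finset ι → ℝ}
    {L : Δ.Chow →ₗ[ℝ] ℝ} (h : Δ.IsDegreeMap d w L) : Δ.IsDegreeMap d w (Δ.degreeMap d w) := by
  have h' : ∃ L : Δ.Chow →ₗ[ℝ] ℝ, Δ.IsDegreeMap d w L := ⟨L, h⟩
  rw [SimplicialFan.degreeMap, dif_pos h']
  exact h'.choose_spec

/-- Poincaré duality with respect to the degree map implies that the degree map exists. -/
theorem isDegreeMap_of_poincareDuality {Δ : SimplicialFan ι V} {d : ℕ} {w : Finset ι → ℝ}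
    (h : SatisfiesPoincareDuality Δ.chowDegree d (Δ.degreeMap d w)) :
    Δ.IsDegreeMap d w (Δ.degreeMap d w) := by
  by_cases h' : ∃ L : Δ.Chow →ₗ[ℝ] ℝ, Δ.IsDegreeMap d w L
  · exact h'.choose_spec.degreeMap
  -- If no degree map exists, `degreeMap` has the default value 0 and cannot take the value 1.
  · obtain ⟨y, hy⟩ := h.bijective_deg.2 1
    rw [SimplicialFan.degreeMap, dif_neg h'] at hy
    simp at hy

end Grading
end SimplicialFan
end

/-! ### Restriction to the link -/

noncomputable section
namespace SimplicialFan

section LinkRestriction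

theorem mem_star_faces {ι V : Type*} [DecidableEq ι] [AddCommGroup V] [Module ℝ V]
    {Δ : SimplicialFan ι V} {τ : Finset ι} {hτ : τ ∈ Δ.faces}
    {σ : Finset ι} :
    σ ∈ (Δ.star τ hτ).faces ↔ σ ∪ τ ∈ Δ.faces := by
  constructor
  · rintro ⟨γ, hγ, h1, h2⟩
    exact Δ.down_closed γ hγ _ (Finset.union_subset h2 h1)
  · intro h1
    exact ⟨_, h1, Finset.subset_union_right, Finset.subset_union_left⟩

variable {ι V : Type*} [Fintype ι] [DecidableEq ι] [AddCommGroup V] [Module ℝ V]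

theorem mem_link_faces {Δ : SimplicialFan ι V} {τ : Finset ι} {hτ : τ ∈ Δ.faces} {σ : Finset ι} :
    σ ∈ (Δ.link τ hτ).faces ↔ σ ∪ τ ∈ Δ.faces ∧ Disjoint σ τ := by
  constructor
  · rintro ⟨⟨γ, hγ, h1, h2⟩, h3⟩
    exact ⟨Δ.down_closed γ hγ _ (Finset.union_subset h2 h1), h3⟩
  · rintro ⟨h1, h2⟩
    exact ⟨⟨_, h1, Finset.subset_union_right, Finset.subset_union_left⟩, h2⟩

theorem sdiff_mem_link_faces {Δ : SimplicialFan ι V} {τ : Finset ι} {hτ : τ ∈ Δ.faces}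
    {σ : Finset ι} : σ \ τ ∈ (Δ.link τ hτ).faces ↔ σ ∪ τ ∈ Δ.faces := by
  rw [mem_link_faces, Finset.sdiff_union_self_eq_union]
  exact and_iff_left Finset.sdiff_disjoint

theorem starInclusion_pullback_x (Δ : SimplicialFan ι V) (τ : Finset ι) (hτ : τ ∈ Δ.faces)
    (j : ι) : (Δ.starInclusion τ hτ).pullback (Δ.x j) = (Δ.star τ hτ).x j := by
  rw [FanMap.pullback_x, Finset.sum_eq_single j]
  · simp [starInclusion]
  · intro i _ hi
    simp [starInclusion, hi]
  · simp

theorem restrictLink_x (Δ : SimplicialFan ι V) (τ : Finset ι) (hτ : τ ∈ Δ.faces) {j : ι}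
    (hj : j ∉ τ) : Δ.restrictLink τ hτ (Δ.x j) = (Δ.link τ hτ).x j := by
  change (Δ.linkStarEquiv τ hτ).symm ((Δ.starInclusion τ hτ).pullback (Δ.x j)) = _
  rw [AlgEquiv.symm_apply_eq, starInclusion_pullback_x]
  exact ((Δ.starProjection_pullback_x τ hτ j).trans (if_neg hj)).symm

theorem restrictLink_prod_x (Δ : SimplicialFan ι V) (τ : Finset ι) (hτ : τ ∈ Δ.faces)
    {σ : Finset ι} (hσ : Disjoint σ τ) :
    Δ.restrictLink τ hτ (∏ i ∈ σ, Δ.x i) = ∏ i ∈ σ, (Δ.link τ hτ).x i := by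
  rw [map_prod]
  exact Finset.prod_congr rfl fun i hi => restrictLink_x _ _ _ (Finset.disjoint_left.mp hσ hi)

theorem restrictLink_prod_x_eq_zero (Δ : SimplicialFan ι V) (τ : Finset ι) (hτ : τ ∈ Δ.faces)
    {σ : Finset ι} (hσ : σ ∪ τ ∉ Δ.faces) :
    Δ.restrictLink τ hτ (∏ i ∈ σ \ τ, Δ.x i) = 0 := by
  rw [restrictLink_prod_x _ _ _ Finset.sdiff_disjoint]
  exact prod_x_eq_zero _ (mt sdiff_mem_link_faces.mp hσ)

/-- Generators outside τ go to generators of the link. Those of τ are first rewritten, by linear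
relations, in terms of generators outside τ, which shows that they too land in degree one. -/
theorem map_restrictLink_chowDegree (Δ : SimplicialFan ι V) (τ : Finset ι) (hτ : τ ∈ Δ.faces)
    (k : ℕ) : (Δ.chowDegree k).map (Δ.restrictLink τ hτ).toLinearMap =
      (Δ.link τ hτ).chowDegree k := by
  apply map_chowDegree_eq
  · intro i
    by_cases hi : i ∈ τ
    · obtain ⟨c, hc, hx⟩ := Δ.exists_x_eq hτ hi
      rw [hx, map_sum]
      refine Submodule.sum_mem _ fun j _ => ?_
      by_cases hj : j ∈ τ
      · simp [hc j hj]
      · rw [map_smul, restrictLink_x _ _ _ hj]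
        exact Submodule.smul_mem _ _ (x_mem_chowDegree _ j)
    · rw [restrictLink_x _ _ _ hi]
      exact x_mem_chowDegree _ i
  · intro j
    by_cases hj : j ∈ τ
    · rw [x_eq_zero (Δ.link τ hτ) fun h =>
        Finset.disjoint_left.mp (mem_link_faces.mp h).2 (Finset.mem_singleton_self j) hj]
      exact zero_mem _
    · exact ⟨Δ.x j, Δ.x_mem_chowDegree j, Δ.restrictLink_x τ hτ hj⟩

/-- An element that annihilates the non-faces of the link annihilates the kernel of the restriction
to the link. -/
theorem mul_map_eq_zero_of_restrictLink_eq_zero (Δ : SimplicialFan ι V) (τ : Finset ι)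
    (hτ : τ ∈ Δ.faces) {H : Type*} [CommRing H] [Algebra ℝ H] (f : Δ.Chow →ₐ[ℝ] H) (u : H)
    (hu : ∀ σ, σ ∪ τ ∉ Δ.faces → u * f (∏ i ∈ σ \ τ, Δ.x i) = 0) {a : Δ.Chow}
    (ha : Δ.restrictLink τ hτ a = 0) : u * f a = 0 := by
  -- Being killed by `u` means vanishing in `H ⧸ J`. It therefore suffices to factor `f` modulo `J`
  -- through the Chow ring of the star, which is isomorphic to that of the link.
  let J : Ideal H := (Submodule.span H {u}).annihilator
  have hJ : ∀ z, Ideal.Quotient.mkₐ ℝ J z = 0 ↔ u * z = 0 := fun z => by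
    rw [Ideal.Quotient.mkₐ_eq_mk, Ideal.Quotient.eq_zero_iff_mem,
      Submodule.mem_annihilator_span_singleton, smul_eq_mul, mul_comm]
  let g : (Δ.star τ hτ).Chow →ₐ[ℝ] H ⧸ J :=
    (Δ.star τ hτ).chowLift (fun i => Ideal.Quotient.mkₐ ℝ J (f (Δ.x i)))
      (fun S hS => by
        rw [← map_prod, ← map_prod, hJ, ← Finset.prod_sdiff (Finset.inter_subset_left : S ∩ τ ⊆ S),
          Finset.sdiff_inter_self_left, map_mul, ← mul_assoc, hu S (mt mem_star_faces.mpr hS),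
          zero_mul])
      (fun θ => by
        simp only [← map_smul, ← map_sum]
        rw [show ∑ i, θ ((Δ.star τ hτ).ray i) • Δ.x i = 0 from Δ.sum_smul_x_eq_zero θ, map_zero,
          map_zero])
  have hg : g.comp (Δ.starInclusion τ hτ).pullback = (Ideal.Quotient.mkₐ ℝ J).comp f := by
    refine chow_hom_ext _ fun i => ?_
    rw [AlgHom.comp_apply, starInclusion_pullback_x, AlgHom.comp_apply]
    exact chowLift_x _ _ _ _ i
  have ha' : (Δ.starInclusion τ hτ).pullback a = 0 :=
    (Δ.linkStarEquiv τ hτ).symm.injective (ha.trans (map_zero _).symm)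
  rw [← hJ, ← AlgHom.comp_apply, ← hg, AlgHom.comp_apply, ha', map_zero]

/-- The monomial of `τ` annihilates the kernel of the restriction to the link of `τ`. -/
theorem prod_x_mul_eq_zero (Δ : SimplicialFan ι V) (τ : Finset ι) (hτ : τ ∈ Δ.faces) {a : Δ.Chow}
    (ha : Δ.restrictLink τ hτ a = 0) : (∏ i ∈ τ, Δ.x i) * a = 0 := by
  refine Δ.mul_map_eq_zero_of_restrictLink_eq_zero τ hτ (AlgHom.id ℝ _) _ (fun σ hσ => ?_) ha
  rw [AlgHom.id_apply, mul_comm, ← Finset.prod_union Finset.sdiff_disjoint,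
    Finset.sdiff_union_self_eq_union, prod_x_eq_zero _ hσ]

/-- The degree map of the link is the degree map of `Δ` on multiples of the monomial of `τ`. -/
theorem IsDegreeMap.prod_x_mul {Δ : SimplicialFan ι V} {d : ℕ} {w : Finset ι → ℝ}
    {τ : Finset ι} {hτ : τ ∈ Δ.faces} (hd : τ.card ≤ d) {L : Δ.Chow →ₗ[ℝ] ℝ}
    {L' : (Δ.link τ hτ).Chow →ₗ[ℝ] ℝ}
    (hL : Δ.IsDegreeMap d w L)
    (hL' : (Δ.link τ hτ).IsDegreeMap (d - τ.card) (restrictWeight τ w) L') {a : Δ.Chow}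
    (ha : a ∈ Δ.chowDegree (d - τ.card)) :
    L ((∏ i ∈ τ, Δ.x i) * a) = L' (Δ.restrictLink τ hτ a) := by
  let M : Submodule ℝ Δ.Chow :=
    LinearMap.eqLocus (L ∘ₗ LinearMap.mulLeft ℝ (∏ i ∈ τ, Δ.x i))
      (L' ∘ₗ (Δ.restrictLink τ hτ).toLinearMap)
  -- On monomials of link cones both sides are the same value of `w`, and these monomials span the
  -- link in this degree.
  have hM : (Δ.link τ hτ).chowDegree (d - τ.card) ≤ M.map (Δ.restrictLink τ hτ).toLinearMap := by
    refine (chowDegree_le_span _ _).trans (Submodule.span_le.mpr ?_)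
    rintro _ ⟨σ, hσ, hk, rfl⟩
    have hσ' := mem_link_faces.mp hσ
    refine ⟨∏ i ∈ σ, Δ.x i, ?_, Δ.restrictLink_prod_x τ hτ hσ'.2⟩
    change L ((∏ i ∈ τ, Δ.x i) * ∏ i ∈ σ, Δ.x i) = L' (Δ.restrictLink τ hτ (∏ i ∈ σ, Δ.x i))
    rw [mul_comm, ← Finset.prod_union hσ'.2, Δ.restrictLink_prod_x τ hτ hσ'.2, hL'.1 σ hσ hk,
      hL.1 _ hσ'.1, restrictWeight]
    rw [Finset.card_union_of_disjoint hσ'.2, hk, Nat.sub_add_cancel hd]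
  obtain ⟨a', ha', h⟩ := hM (Δ.map_restrictLink_chowDegree τ hτ _ ▸ Submodule.mem_map_of_mem ha)
  have h' : Δ.restrictLink τ hτ a' = Δ.restrictLink τ hτ a := h
  -- So `a` agrees with some element of `M` up to the kernel of restriction, which the monomial of τ
  -- annihilates.
  have h0 := Δ.prod_x_mul_eq_zero τ hτ (a := a - a') (by rw [map_sub, h', sub_self])
  rw [mul_sub, sub_eq_zero] at h0
  rw [h0, ← h']
  exact ha'

theorem IsPure.link_chowDegree_eq_bot {Δ : SimplicialFan ι V} {d : ℕ} (hd : Δ.IsPure d)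
    {τ : Finset ι} (hτ : τ ∈ Δ.faces) {k : ℕ} (hk : d - τ.card < k) :
    (Δ.link τ hτ).chowDegree k = ⊥ := by
  refine chowDegree_eq_bot _ fun σ hσ => ?_
  obtain ⟨h1, h2⟩ := mem_link_faces.mp hσ
  have := hd.card_le h1
  rw [Finset.card_union_of_disjoint h2] at this
  omega

end LinkRestriction

end SimplicialFan
end

/-! ### The Chow ring of the star subdivision -/

noncomputable section
namespace SimplicialFan

section Subdivision

theorem prod_option_finset {ι M : Type*} [DecidableEq ι] [CommMonoid M] (f : Option ι → M) (σ : Finset (Option ι)) :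
    ∏ i ∈ σ, f i = (if none ∈ σ then f none else 1) * ∏ i ∈ σ.eraseNone, f (some i) := by
  have h : ∏ i ∈ σ.eraseNone, f (some i) = ∏ i ∈ σ.erase none, f i := by
    rw [← Finset.map_some_eraseNone, Finset.prod_map]
    rfl
  rw [h]
  split_ifs with hn
  · rw [Finset.mul_prod_erase σ f hn]
  · rw [Finset.erase_eq_of_notMem hn, one_mul]

variable {ι V : Type*} [Fintype ι] [DecidableEq ι] [AddCommGroup V] [Module ℝ V]

theorem mem_starSubdivision_faces {Δ : SimplicialFan ι V} {τ : Finset ι} {hτ : τ ∈ Δ.faces}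
    {hτ2 : τ.card = 2} {σ : Finset (Option ι)} :
    σ ∈ (Δ.starSubdivision τ hτ hτ2).faces ↔ ¬ τ ⊆ σ.eraseNone ∧ σ.eraseNone ∈ Δ.faces ∧
      (none ∈ σ → σ.eraseNone ∪ τ ∈ Δ.faces) := by
  rw [← mem_star_faces (hτ := hτ)]
  rfl

/-- The algebra that describes the Chow ring of the star subdivision: it is obtained from the Chow
ring of `Δ` by adjoining a root `ω` of `(x₁ - ω) * (x₂ - ω)` that annihilates the kernel of the
restriction to the link of `τ`. -/
abbrev SubdivisionAlgebra (Δ : SimplicialFan ι V) (τ : Finset ι) (hτ : τ ∈ Δ.faces) : Type _ :=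
  BlowupAlgebra (Δ.restrictLink τ hτ) (∑ i ∈ τ, Δ.x i) (∏ i ∈ τ, Δ.x i)
    fun _ => Δ.prod_x_mul_eq_zero τ hτ

/-- The map from the Chow ring of `Δ`. -/
def subdivisionOf (Δ : SimplicialFan ι V) (τ : Finset ι) (hτ : τ ∈ Δ.faces) :
    Δ.Chow →ₐ[ℝ] Δ.SubdivisionAlgebra τ hτ :=
  BlowupAlgebra.of _ _ _ _

/-- The images of the generators of the Chow ring of the star subdivision. -/
def subdivisionGenerator (Δ : SimplicialFan ι V) (τ : Finset ι) (hτ : τ ∈ Δ.faces) :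
    Option ι → Δ.SubdivisionAlgebra τ hτ
  | none => BlowupAlgebra.omega _ _ _ _
  -- Forced by s*x_i = x_i + x₀ for i in τ.
  | some i => Δ.subdivisionOf τ hτ (Δ.x i) -
      if i ∈ τ then BlowupAlgebra.omega _ _ _ _ else 0

theorem subdivisionGenerator_none_mul_eq_zero (Δ : SimplicialFan ι V) {τ : Finset ι}
    (hτ : τ ∈ Δ.faces) {a : Δ.Chow} (ha : Δ.restrictLink τ hτ a = 0) :
    Δ.subdivisionGenerator τ hτ none * Δ.subdivisionOf τ hτ a = 0 :=
  BlowupAlgebra.omega_mul_of_eq_zero _ _ _ _ ha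

theorem subdivisionGenerator_none_sq (Δ : SimplicialFan ι V) {τ : Finset ι}
    (hτ : τ ∈ Δ.faces) : Δ.subdivisionGenerator τ hτ none ^ 2 =
      Δ.subdivisionOf τ hτ (∑ i ∈ τ, Δ.x i) * Δ.subdivisionGenerator τ hτ none -
        Δ.subdivisionOf τ hτ (∏ i ∈ τ, Δ.x i) :=
  BlowupAlgebra.omega_sq _ _ _ _

theorem subdivisionGenerator_some (Δ : SimplicialFan ι V) {τ : Finset ι}
    (hτ : τ ∈ Δ.faces) (i : ι) : Δ.subdivisionGenerator τ hτ (some i) =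
      Δ.subdivisionOf τ hτ (Δ.x i) - if i ∈ τ then Δ.subdivisionGenerator τ hτ none else 0 :=
  rfl

/-- The quadratic relation of ω is the expansion of (x_j - ω)(x_k - ω) = 0, chosen so that the
monomial of the removed cone τ vanishes. -/
theorem prod_subdivisionGenerator_self (Δ : SimplicialFan ι V) {τ : Finset ι} (hτ : τ ∈ Δ.faces)
    (hτ2 : τ.card = 2) : ∏ i ∈ τ, Δ.subdivisionGenerator τ hτ (some i) = 0 := by
  obtain ⟨j, k, hjk, h⟩ := Finset.card_eq_two.mp hτ2
  have hj : j ∈ τ := by simp [h]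
  have hk : k ∈ τ := by simp [h]
  have hsum : Δ.subdivisionOf τ hτ (∑ i ∈ τ, Δ.x i) =
      Δ.subdivisionOf τ hτ (Δ.x j) + Δ.subdivisionOf τ hτ (Δ.x k) := by
    rw [map_sum]
    exact (Finset.sum_congr h fun _ _ => rfl).trans (Finset.sum_pair hjk)
  have hprod : Δ.subdivisionOf τ hτ (∏ i ∈ τ, Δ.x i) =
      Δ.subdivisionOf τ hτ (Δ.x j) * Δ.subdivisionOf τ hτ (Δ.x k) := by
    rw [map_prod]
    exact (Finset.prod_congr h fun _ _ => rfl).trans (Finset.prod_pair hjk)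
  have hsq := Δ.subdivisionGenerator_none_sq hτ
  rw [hsum, hprod] at hsq
  rw [(Finset.prod_congr h fun _ _ => rfl).trans (Finset.prod_pair hjk),
    subdivisionGenerator_some, subdivisionGenerator_some, if_pos hj, if_pos hk]
  linear_combination hsq

/-- The product over a set that meets `τ` in at most one element. -/
theorem prod_subdivisionGenerator (Δ : SimplicialFan ι V) {τ ρ : Finset ι} (hτ : τ ∈ Δ.faces)
    (hτ2 : τ.card = 2) (hρ : ¬ τ ⊆ ρ) : ∏ i ∈ ρ, Δ.subdivisionGenerator τ hτ (some i) =
      Δ.subdivisionOf τ hτ (∏ i ∈ ρ, Δ.x i) - Δ.subdivisionGenerator τ hτ none *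
        if Disjoint ρ τ then 0 else Δ.subdivisionOf τ hτ (∏ i ∈ ρ \ τ, Δ.x i) := by
  have hdisj : ∀ γ : Finset ι, Disjoint γ τ → ∏ i ∈ γ, Δ.subdivisionGenerator τ hτ (some i) =
      Δ.subdivisionOf τ hτ (∏ i ∈ γ, Δ.x i) := by
    intro γ hγ
    rw [map_prod]
    refine Finset.prod_congr rfl fun i hi => ?_
    rw [subdivisionGenerator_some, if_neg (Finset.disjoint_left.mp hγ hi), sub_zero]
  split_ifs with h
  · rw [mul_zero, sub_zero]
    exact hdisj ρ h
  · obtain ⟨k, hk, hkτ⟩ := Finset.not_disjoint_iff.mp h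
    -- As τ has two rays and is not contained in ρ, it meets ρ in one ray k only; the product is
    -- (x_k - ω) times the monomial of ρ \ τ.
    have hinter : τ ∩ ρ = {k} := by
      have h1 : (τ ∩ ρ).card < τ.card := Finset.card_lt_card
        (Finset.ssubset_iff_subset_ne.mpr ⟨Finset.inter_subset_left, fun h =>
          hρ (Finset.inter_eq_left.mp h)⟩)
      exact (Finset.eq_of_subset_of_card_le (by simp [hk, hkτ]) (by simp; omega)).symm
    have herase : ρ \ τ = ρ.erase k := by
      rw [← Finset.sdiff_inter_self_right, hinter, Finset.sdiff_singleton_eq_erase]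
    rw [← Finset.mul_prod_erase ρ _ hk, ← Finset.mul_prod_erase ρ Δ.x hk, ← herase,
      hdisj _ Finset.sdiff_disjoint, subdivisionGenerator_some, if_pos hkτ, map_mul]
    ring

/-- The homomorphism from the Chow ring of the star subdivision to the algebra that describes
it. -/
def subdivisionLift (Δ : SimplicialFan ι V) (τ : Finset ι) (hτ : τ ∈ Δ.faces)
    (hτ2 : τ.card = 2) :
    (Δ.starSubdivision τ hτ hτ2).Chow →ₐ[ℝ] Δ.SubdivisionAlgebra τ hτ :=
  (Δ.starSubdivision τ hτ hτ2).chowLift (Δ.subdivisionGenerator τ hτ)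
    (by
      intro S hS
      rw [prod_option_finset]
      by_cases h1 : τ ⊆ S.eraseNone
      · rw [← Finset.prod_sdiff h1, prod_subdivisionGenerator_self Δ hτ hτ2, mul_zero, mul_zero]
      · rw [prod_subdivisionGenerator Δ hτ hτ2 h1]
        have h2 : S.eraseNone ∪ τ ∉ Δ.faces → Δ.subdivisionGenerator τ hτ none *
            Δ.subdivisionOf τ hτ (∏ i ∈ S.eraseNone \ τ, Δ.x i) = 0 := fun h =>
          Δ.subdivisionGenerator_none_mul_eq_zero hτ (Δ.restrictLink_prod_x_eq_zero τ hτ h)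
        -- Otherwise `S` would be a cone of the subdivision, whether or not it contains v₀.
        have h3 : S.eraseNone ∪ τ ∉ Δ.faces := by
          intro h
          exact hS (mem_starSubdivision_faces.mpr
            ⟨h1, Δ.down_closed _ h _ Finset.subset_union_left, fun _ => h⟩)
        rw [mul_ite, mul_zero, h2 h3, ite_self, sub_zero]
        by_cases h4 : S.eraseNone ∈ Δ.faces
        · have h5 : none ∈ S := by
            rw [mem_starSubdivision_faces] at hS
            tauto
          rw [if_pos h5, ← Finset.prod_sdiff
              (Finset.inter_subset_left : S.eraseNone ∩ τ ⊆ S.eraseNone),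
              Finset.sdiff_inter_self_left, map_mul, ← mul_assoc, h2 h3, zero_mul]
        · rw [Δ.prod_x_eq_zero h4, map_zero, mul_zero])
    (by
      intro θ
      rw [Fintype.sum_option]
      have h1 : ∀ i, (Δ.starSubdivision τ hτ hτ2).ray (some i) = Δ.ray i := fun _ => rfl
      have h2 : (Δ.starSubdivision τ hτ hτ2).ray none = ∑ j ∈ τ, Δ.ray j := rfl
      have h3 : ∀ i, θ (Δ.ray i) • Δ.subdivisionGenerator τ hτ (some i) =
          Δ.subdivisionOf τ hτ (θ (Δ.ray i) • Δ.x i) -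
            if i ∈ τ then θ (Δ.ray i) • Δ.subdivisionGenerator τ hτ none else 0 := by
        intro i
        rw [subdivisionGenerator_some, smul_sub, map_smul, smul_ite, smul_zero]
      -- The terms in ω cancel because v₀ is the sum of the generators of τ.
      simp only [h1, h2, h3, Finset.sum_sub_distrib, ← map_sum, Δ.sum_smul_x_eq_zero,
        Finset.sum_ite_mem, Finset.univ_inter, ← Finset.sum_smul]
      rw [map_zero, zero_sub, add_neg_cancel])

theorem subdivisionLift_x (Δ : SimplicialFan ι V) (τ : Finset ι) (hτ : τ ∈ Δ.faces)
    (hτ2 : τ.card = 2) (i : Option ι) :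
    Δ.subdivisionLift τ hτ hτ2 ((Δ.starSubdivision τ hτ hτ2).x i) =
      Δ.subdivisionGenerator τ hτ i :=
  chowLift_x _ _ _ _ i

theorem subdivisionMap_pullback_x (Δ : SimplicialFan ι V) (τ : Finset ι) (hτ : τ ∈ Δ.faces)
    (hτ2 : τ.card = 2) (j : ι) :
    (Δ.subdivisionMap τ hτ hτ2).pullback (Δ.x j) =
      (Δ.starSubdivision τ hτ hτ2).x (some j) +
        if j ∈ τ then (Δ.starSubdivision τ hτ hτ2).x none else 0 := by
  rw [FanMap.pullback_x, Fintype.sum_option, add_comm]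
  simp [subdivisionMap]

theorem subdivisionLift_pullback (Δ : SimplicialFan ι V) (τ : Finset ι) (hτ : τ ∈ Δ.faces)
    (hτ2 : τ.card = 2) (a : Δ.Chow) :
    Δ.subdivisionLift τ hτ hτ2 ((Δ.subdivisionMap τ hτ hτ2).pullback a) =
      Δ.subdivisionOf τ hτ a := by
  have h : (Δ.subdivisionLift τ hτ hτ2).comp (Δ.subdivisionMap τ hτ hτ2).pullback =
      Δ.subdivisionOf τ hτ := by
    refine chow_hom_ext _ fun i => ?_
    rw [AlgHom.comp_apply, subdivisionMap_pullback_x, map_add, subdivisionLift_x,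
      apply_ite (Δ.subdivisionLift τ hτ hτ2), subdivisionLift_x, map_zero,
      subdivisionGenerator_some, sub_add_cancel]
  exact AlgHom.congr_fun h a

theorem subdivisionLift_add (Δ : SimplicialFan ι V) (τ : Finset ι) (hτ : τ ∈ Δ.faces)
    (hτ2 : τ.card = 2) (a a' : Δ.Chow) :
    Δ.subdivisionLift τ hτ hτ2 ((Δ.subdivisionMap τ hτ hτ2).pullback a +
      (Δ.starSubdivision τ hτ hτ2).x none * (Δ.subdivisionMap τ hτ hτ2).pullback a') =
        Δ.subdivisionOf τ hτ a +
          Δ.subdivisionGenerator τ hτ none * Δ.subdivisionOf τ hτ a' := by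
  rw [map_add, map_mul, subdivisionLift_pullback, subdivisionLift_pullback, subdivisionLift_x]

/-- The new ray lies only in cones coming from the star of τ: if σ ∪ τ is no cone of Δ, then v₀ and
σ \ τ span no cone of the subdivision. -/
theorem x_none_mul_pullback_eq_zero (Δ : SimplicialFan ι V) (τ : Finset ι) (hτ : τ ∈ Δ.faces)
    (hτ2 : τ.card = 2) {a : Δ.Chow} (ha : Δ.restrictLink τ hτ a = 0) :
    (Δ.starSubdivision τ hτ hτ2).x none * (Δ.subdivisionMap τ hτ hτ2).pullback a = 0 := by
  refine Δ.mul_map_eq_zero_of_restrictLink_eq_zero τ hτ _ _ (fun σ hσ => ?_) ha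
  have h1 : (Δ.subdivisionMap τ hτ hτ2).pullback (∏ i ∈ σ \ τ, Δ.x i) =
      ∏ i ∈ σ \ τ, (Δ.starSubdivision τ hτ hτ2).x (some i) := by
    rw [map_prod]
    refine Finset.prod_congr rfl fun i hi => ?_
    rw [subdivisionMap_pullback_x, if_neg (Finset.mem_sdiff.mp hi).2, add_zero]
  have h2 := prod_option_finset (Δ.starSubdivision τ hτ hτ2).x (Finset.insertNone (σ \ τ))
  rw [if_pos (Finset.none_mem_insertNone), Finset.eraseNone_insertNone] at h2
  rw [h1, ← h2]
  refine prod_x_eq_zero _ fun h => hσ ?_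
  have := (mem_starSubdivision_faces.mp h).2.2 Finset.none_mem_insertNone
  rwa [Finset.eraseNone_insertNone, Finset.sdiff_union_self_eq_union] at this

/-- Expansion of the Stanley–Reisner relation of the two generators of τ, which no longer span a
cone, with each written as its pullback minus x₀. -/
theorem x_none_sq (Δ : SimplicialFan ι V) (τ : Finset ι) (hτ : τ ∈ Δ.faces)
    (hτ2 : τ.card = 2) :
    (Δ.starSubdivision τ hτ hτ2).x none ^ 2 =
      (Δ.subdivisionMap τ hτ hτ2).pullback (∑ i ∈ τ, Δ.x i) *
        (Δ.starSubdivision τ hτ hτ2).x none -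
        (Δ.subdivisionMap τ hτ hτ2).pullback (∏ i ∈ τ, Δ.x i) := by
  obtain ⟨j, k, hjk, h⟩ := Finset.card_eq_two.mp hτ2
  have hj : j ∈ τ := by simp [h]
  have hk : k ∈ τ := by simp [h]
  have hsum : ∑ i ∈ τ, Δ.x i = Δ.x j + Δ.x k :=
    (Finset.sum_congr h fun _ _ => rfl).trans (Finset.sum_pair hjk)
  have hprod : ∏ i ∈ τ, Δ.x i = Δ.x j * Δ.x k :=
    (Finset.prod_congr h fun _ _ => rfl).trans (Finset.prod_pair hjk)
  have h0 : (Δ.starSubdivision τ hτ hτ2).x (some j) * (Δ.starSubdivision τ hτ hτ2).x (some k) =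
      0 := by
    rw [← Finset.prod_pair (by simpa using hjk)]
    refine prod_x_eq_zero _ fun h' => (mem_starSubdivision_faces.mp h').1 fun i hi => ?_
    rw [h] at hi
    simpa using hi
  rw [hsum, hprod, map_add, map_mul, subdivisionMap_pullback_x, subdivisionMap_pullback_x,
    if_pos hj, if_pos hk]
  linear_combination h0

/-- Spanning holds because normal forms are stable under multiplication by every generator.
Uniqueness is read off in the model algebra through `subdivisionLift`. -/
theorem isBlowupDecomposition (Δ : SimplicialFan ι V) (τ : Finset ι) (hτ : τ ∈ Δ.faces)
    (hτ2 : τ.card = 2) :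
    IsBlowupDecomposition Δ.chowDegree (Δ.starSubdivision τ hτ hτ2).chowDegree
      (Δ.link τ hτ).chowDegree (Δ.subdivisionMap τ hτ hτ2).pullback (Δ.restrictLink τ hτ)
      ((Δ.starSubdivision τ hτ hτ2).x none) where
  exists_eq := by
    set s := (Δ.subdivisionMap τ hτ hτ2).pullback with hs
    set t := (Δ.starSubdivision τ hτ hτ2).x none with ht
    have he₁ : ∑ i ∈ τ, Δ.x i ∈ Δ.chowDegree 1 :=
      Submodule.sum_mem _ fun i _ => Δ.x_mem_chowDegree i
    have he₂ : ∏ i ∈ τ, Δ.x i ∈ Δ.chowDegree 2 := hτ2 ▸ Δ.prod_x_mem_chowDegree τ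
    let M : ℕ → Submodule ℝ (Δ.starSubdivision τ hτ hτ2).Chow := fun k =>
      (Δ.chowDegree k).map s.toLinearMap ⊔
        (shiftGrading Δ.chowDegree k).map (LinearMap.mulLeft ℝ t ∘ₗ s.toLinearMap)
    have hM : ∀ k, ∀ a ∈ Δ.chowDegree k, ∀ a' ∈ shiftGrading Δ.chowDegree k,
        s a + t * s a' ∈ M k := fun k a ha a' ha' =>
      Submodule.add_mem_sup (Submodule.mem_map_of_mem ha) (Submodule.mem_map_of_mem ha')
    have hM' : ∀ k, ∀ b ∈ M k, ∃ a ∈ Δ.chowDegree k, ∃ a' ∈ shiftGrading Δ.chowDegree k,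
        b = s a + t * s a' := by
      intro k b hb
      obtain ⟨_, ⟨a, ha, rfl⟩, _, ⟨a', ha', rfl⟩, rfl⟩ := Submodule.mem_sup.mp hb
      exact ⟨a, ha, a', ha', rfl⟩
    have hmul_t : ∀ k, ∀ y ∈ M k, t * y ∈ M (k + 1) := by
      intro k y hy
      obtain ⟨a, ha, a', ha', rfl⟩ := hM' k y hy
      -- Here x₀² is eliminated by `x_none_sq`.
      have h1 : t * (s a + t * s a') =
          s (-((∏ i ∈ τ, Δ.x i) * a')) + t * s (a + (∑ i ∈ τ, Δ.x i) * a') := by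
        have := Δ.x_none_sq τ hτ hτ2
        rw [← hs, ← ht] at this
        rw [map_neg, map_mul, map_add, map_mul]
        linear_combination (s a') * this
      rw [h1]
      refine hM _ _ (Submodule.neg_mem _ ?_) _
        (show _ ∈ Δ.chowDegree k from Submodule.add_mem _ ha
          (IsBlowupDecomposition.mul_mem_of_mem_shiftGrading he₁ ha'))
      have := IsBlowupDecomposition.mul_mem_shiftGrading he₂ ha'
      rwa [add_comm] at this
    have hmul_s : ∀ i k, ∀ y ∈ M k, s (Δ.x i) * y ∈ M (k + 1) := by
      intro i k y hy
      obtain ⟨a, ha, a', ha', rfl⟩ := hM' k y hy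
      have h1 : s (Δ.x i) * (s a + t * s a') = s (Δ.x i * a) + t * s (Δ.x i * a') := by
        rw [map_mul, map_mul]
        ring
      rw [h1, add_comm k]
      exact hM _ _ (SetLike.mul_mem_graded (Δ.x_mem_chowDegree i) ha) _
        (IsBlowupDecomposition.mul_mem_shiftGrading (Δ.x_mem_chowDegree i) ha')
    have key : ∀ k, (Δ.starSubdivision τ hτ hτ2).chowDegree k ≤ M k := by
      intro k
      induction k with
      | zero =>
        refine chowDegree_zero_le _ ?_
        simpa using hM 0 1 (SetLike.one_mem_graded Δ.chowDegree) 0 (zero_mem _)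
      | succ k ih =>
        refine chowDegree_succ_le _ fun i y hy => ?_
        cases i with
        | none => exact hmul_t k y (ih hy)
        | some i =>
          -- An old generator is its pullback, minus x₀ if i is in τ; multiplication by either
          -- preserves normal forms.
          have h1 := hmul_s i k y (ih hy)
          rw [hs, subdivisionMap_pullback_x, add_mul] at h1
          split_ifs at h1
          · exact (Submodule.add_mem_iff_left _ (hmul_t k y (ih hy))).mp h1
          · rwa [zero_mul, add_zero] at h1
    exact fun k b hb => hM' k b (key k hb)
  add_mem k a ha a' ha' := by
    have hs : ∀ i, ∀ b ∈ Δ.chowDegree i, (Δ.subdivisionMap τ hτ hτ2).pullback b ∈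
        (Δ.starSubdivision τ hτ hτ2).chowDegree i := by
      intro i b hb
      refine map_mem_chowDegree _ (fun j => ?_) hb
      rw [subdivisionMap_pullback_x]
      refine Submodule.add_mem _ (x_mem_chowDegree _ _) ?_
      split_ifs
      · exact x_mem_chowDegree _ _
      · exact zero_mem _
    refine Submodule.add_mem _ (hs k a ha) ?_
    cases k with
    | zero =>
      rw [(Submodule.mem_bot ℝ).mp ha', map_zero, mul_zero]
      exact zero_mem _
    | succ k =>
      rw [add_comm k]
      exact SetLike.mul_mem_graded (x_mem_chowDegree _ _) (hs k a' ha')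
  eq_zero_iff a a' := by
    constructor
    · intro h
      have h1 := Δ.subdivisionLift_add τ hτ hτ2 a a'
      rw [h, map_zero] at h1
      exact (BlowupAlgebra.of_add_omega_mul_eq_zero_iff _ _ _ _ a a').mp h1.symm
    · rintro ⟨rfl, h⟩
      rw [map_zero, zero_add, Δ.x_none_mul_pullback_eq_zero τ hτ hτ2 h]
  map_eq := Δ.map_restrictLink_chowDegree τ hτ

/-- The degree map of `Δ`, extended to the star subdivision. -/
def subdivisionDegree (Δ : SimplicialFan ι V) (τ : Finset ι) (hτ : τ ∈ Δ.faces)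
    (hτ2 : τ.card = 2) (L : Δ.Chow →ₗ[ℝ] ℝ) : (Δ.starSubdivision τ hτ hτ2).Chow →ₗ[ℝ] ℝ :=
  L ∘ₗ BlowupAlgebra.re _ _ _ _ ∘ₗ (Δ.subdivisionLift τ hτ hτ2).toLinearMap

theorem subdivisionDegree_add (Δ : SimplicialFan ι V) (τ : Finset ι) (hτ : τ ∈ Δ.faces)
    (hτ2 : τ.card = 2) (L : Δ.Chow →ₗ[ℝ] ℝ) (a a' : Δ.Chow) :
    Δ.subdivisionDegree τ hτ hτ2 L ((Δ.subdivisionMap τ hτ hτ2).pullback a +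
      (Δ.starSubdivision τ hτ hτ2).x none * (Δ.subdivisionMap τ hτ hτ2).pullback a') = L a := by
  have h : BlowupAlgebra.re _ _ _ _ (Δ.subdivisionLift τ hτ hτ2
      ((Δ.subdivisionMap τ hτ hτ2).pullback a +
        (Δ.starSubdivision τ hτ hτ2).x none * (Δ.subdivisionMap τ hτ hτ2).pullback a')) = a := by
    rw [subdivisionLift_add]
    exact BlowupAlgebra.re_of_add_omega_mul _ _ _ _ a a'
  exact congrArg L h

/-- The value on a maximal cone is `L` of the constant coefficient of its monomial in the model
algebra. Without v₀ this coefficient is the same monomial in Δ. With v₀ it comes from the -e₂ in ω²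
and is the monomial of the cone of Δ obtained by replacing v₀ by the missing ray of τ. -/
theorem IsDegreeMap.subdivisionDegree {Δ : SimplicialFan ι V} {d : ℕ} (hd : Δ.IsPure d)
    {w : Finset ι → ℝ} {L : Δ.Chow →ₗ[ℝ] ℝ} (hL : Δ.IsDegreeMap d w L) {τ : Finset ι}
    (hτ : τ ∈ Δ.faces) (hτ2 : τ.card = 2) :
    (Δ.starSubdivision τ hτ hτ2).IsDegreeMap d (subdivisionWeight τ w)
      (Δ.subdivisionDegree τ hτ hτ2 L) := by
  constructor
  · intro σ hσ hk
    obtain ⟨h1, h2, h3⟩ := mem_starSubdivision_faces.mp hσ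
    have hval : ∀ a a' : Δ.Chow, ∏ i ∈ σ, Δ.subdivisionGenerator τ hτ i =
        Δ.subdivisionOf τ hτ a + Δ.subdivisionGenerator τ hτ none * Δ.subdivisionOf τ hτ a' →
        Δ.subdivisionDegree τ hτ hτ2 L (∏ i ∈ σ, (Δ.starSubdivision τ hτ hτ2).x i) = L a := by
      intro a a' h
      refine congrArg L ?_
      change BlowupAlgebra.re _ _ _ _ (Δ.subdivisionLift τ hτ hτ2 _) = a
      simp only [map_prod, subdivisionLift_x, h]
      exact BlowupAlgebra.re_of_add_omega_mul _ _ _ _ a a'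
    rw [subdivisionWeight]
    have hprod := prod_option_finset (Δ.subdivisionGenerator τ hτ) σ
    rw [prod_subdivisionGenerator Δ hτ hτ2 h1] at hprod
    have hcard : (if none ∈ σ then 1 else 0) + σ.eraseNone.card = d := by
      rw [← hk]
      split_ifs with hn
      · rw [Finset.card_eraseNone_of_mem hn]
        have := Finset.card_pos.mpr ⟨_, hn⟩
        omega
      · rw [Finset.card_eraseNone_of_not_mem hn, zero_add]
    split_ifs at hprod hcard ⊢ with hn hdisj hdisj
    -- A cone with v₀ and no ray of τ would yield, after replacing v₀ by τ, a cone of dimension d +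
    -- 1.
    · have h4 := hd.card_le (h3 hn)
      rw [Finset.card_union_of_disjoint hdisj] at h4
      omega
    · rw [hval (∏ i ∈ σ.eraseNone ∪ τ, Δ.x i)
        ((∏ i ∈ σ.eraseNone, Δ.x i) - (∑ i ∈ τ, Δ.x i) * ∏ i ∈ σ.eraseNone \ τ, Δ.x i)]
      · refine hL.1 _ (h3 hn) ?_
        -- The counts show that σ contains exactly one ray of τ, so its old rays together with τ
        -- form a cone of dimension d.
        have h4 : (σ.eraseNone \ τ).card + (σ.eraseNone ∩ τ).card = σ.eraseNone.card :=
          Finset.card_sdiff_add_card_inter _ _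
        have h5 : (σ.eraseNone ∪ τ).card = (σ.eraseNone \ τ).card + 2 := by
          rw [← Finset.sdiff_union_self_eq_union,
            Finset.card_union_of_disjoint Finset.sdiff_disjoint, hτ2]
        have h6 : 0 < (σ.eraseNone ∩ τ).card := Finset.card_pos.mpr
          (Finset.nonempty_iff_ne_empty.mpr fun h => hdisj (Finset.disjoint_iff_inter_eq_empty.mpr h))
        have h7 : (σ.eraseNone ∩ τ).card < τ.card := Finset.card_lt_card
          (Finset.ssubset_iff_subset_ne.mpr ⟨Finset.inter_subset_right, fun h =>
            h1 (Finset.inter_eq_right.mp h)⟩)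
        omega
      · rw [hprod, ← Finset.sdiff_union_self_eq_union, Finset.prod_union Finset.sdiff_disjoint,
          map_sub, map_mul, map_mul]
        linear_combination -(Δ.subdivisionOf τ hτ (∏ i ∈ σ.eraseNone \ τ, Δ.x i)) *
          Δ.subdivisionGenerator_none_sq hτ
    · rw [hval (∏ i ∈ σ.eraseNone, Δ.x i) 0 (by rw [hprod, map_zero]; ring)]
      exact hL.1 _ h2 (by omega)
    · rw [hval (∏ i ∈ σ.eraseNone, Δ.x i) (-∏ i ∈ σ.eraseNone \ τ, Δ.x i)
        (by rw [hprod, map_neg]; ring)]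
      exact hL.1 _ h2 (by omega)
  · intro k hk y hy
    obtain ⟨a, ha, a', -, rfl⟩ := (Δ.isBlowupDecomposition τ hτ hτ2).exists_eq k y hy
    rw [subdivisionDegree_add]
    exact hL.2 k hk a ha

end Subdivision

end SimplicialFan
end

/-! ### The proposition -/

theorem mainTheorem2 {ι V : Type*} [Fintype ι] [DecidableEq ι] [AddCommGroup V] [Module ℝ V]
    [FiniteDimensional ℝ V] (Δ : SimplicialFan ι V) (d : ℕ) (hd : Δ.IsPure d)
    (w : Finset ι → ℝ) (hw : Δ.IsMinkowskiWeight d w)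
    (τ : Finset ι) (hτ : τ ∈ Δ.faces) (hτ2 : τ.card = 2)
    (ℓ : Δ.Chow) (hℓ : ℓ ∈ Δ.chowDegree 1) :
    -- Hard Lefschetz
    (SatisfiesHardLefschetz Δ.chowDegree d ℓ →
      SatisfiesHardLefschetz (Δ.link τ hτ).chowDegree (d - 2) (Δ.restrictLink τ hτ ℓ) →
      SatisfiesHardLefschetz (Δ.starSubdivision τ hτ hτ2).chowDegree d
        ((Δ.subdivisionMap τ hτ hτ2).pullback ℓ)) ∧
    -- Poincaré duality and the Hodge-Riemann relations, for the degree maps induced by `w`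
    (SatisfiesPoincareDuality Δ.chowDegree d (Δ.degreeMap d w) →
      SatisfiesPoincareDuality (Δ.link τ hτ).chowDegree (d - 2)
        ((Δ.link τ hτ).degreeMap (d - 2) (SimplicialFan.restrictWeight τ w)) →
      SatisfiesPoincareDuality (Δ.starSubdivision τ hτ hτ2).chowDegree d
        ((Δ.starSubdivision τ hτ hτ2).degreeMap d (SimplicialFan.subdivisionWeight τ w)) ∧
      (SatisfiesHodgeRiemann Δ.chowDegree d (Δ.degreeMap d w) ℓ →
        SatisfiesHodgeRiemann (Δ.link τ hτ).chowDegree (d - 2)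
          ((Δ.link τ hτ).degreeMap (d - 2) (SimplicialFan.restrictWeight τ w))
          (Δ.restrictLink τ hτ ℓ) →
        SatisfiesHodgeRiemann (Δ.starSubdivision τ hτ hτ2).chowDegree d
          ((Δ.starSubdivision τ hτ hτ2).degreeMap d (SimplicialFan.subdivisionWeight τ w))
          ((Δ.subdivisionMap τ hτ hτ2).pullback ℓ))) := by
  have hd2 : 2 ≤ d := hτ2 ▸ hd.card_le hτ
  have h := Δ.isBlowupDecomposition τ hτ hτ2
  have hC : ∀ k, d - 2 < k → (Δ.link τ hτ).chowDegree k = ⊥ := fun k hk =>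
    hd.link_chowDegree_eq_bot hτ (by rwa [hτ2])
  refine ⟨h.hardLefschetz hd2 hC hℓ, fun hA hL => ?_⟩
  have hdegA := SimplicialFan.isDegreeMap_of_poincareDuality hA
  have hdegC := SimplicialFan.isDegreeMap_of_poincareDuality hL
  have hdegB := hdegA.subdivisionDegree hd hτ hτ2
  have he₁ : ∑ i ∈ τ, Δ.x i ∈ Δ.chowDegree 1 :=
    Submodule.sum_mem _ fun i _ => Δ.x_mem_chowDegree i
  have he₂ : ∏ i ∈ τ, Δ.x i ∈ Δ.chowDegree 2 := hτ2 ▸ Δ.prod_x_mem_chowDegree τ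
  -- In degree d, `degreeMap` of the subdivision agrees with the explicit `subdivisionDegree`, since
  -- both have the same values on cones.
  have hB : ∀ a ∈ Δ.chowDegree d, (Δ.starSubdivision τ hτ hτ2).degreeMap d
      (SimplicialFan.subdivisionWeight τ w) ((Δ.subdivisionMap τ hτ hτ2).pullback a) =
        Δ.degreeMap d w a := fun a ha => by
    rw [hdegB.degreeMap.eq_of_mem hdegB (h.map_mem_left ha)]
    simpa using Δ.subdivisionDegree_add τ hτ hτ2 (Δ.degreeMap d w) a 0
  have hAC : ∀ a ∈ Δ.chowDegree (d - 2), Δ.degreeMap d w ((∏ i ∈ τ, Δ.x i) * a) =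
      (Δ.link τ hτ).degreeMap (d - 2) (SimplicialFan.restrictWeight τ w)
        (Δ.restrictLink τ hτ a) := by
    rw [← hτ2] at hdegC ⊢
    exact fun a ha => hdegA.prod_x_mul (hτ2 ▸ hd2) hdegC ha
  exact ⟨h.poincareDuality hd2 he₁ he₂ (Δ.x_none_sq τ hτ hτ2) hB hAC hA hL, fun hAR hLR =>
    h.hodgeRiemann hd2 he₁ he₂ (Δ.x_none_sq τ hτ hτ2) hB (hC _ (by omega)) hAC hℓ hAR hLR⟩
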